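/- \textbf{Validity of $\beta_v$-reduction for the optimised encoding.} \emph{Terms.} $M,N ::= x \mid \lambda x.M \mid M\,N$ are the (possibly open) untyped $\lambda$-terms, values are $V ::= x \mid \lambda x.M$, evaluation contexts are $E ::= [\cdot] \mid V\,E \mid E\,M$, and call-by-value reduction is $E[(\lambda x.M)\,V] \to E[M\{V/x\}]$. \emph{Processes.} Processes of the polyadic internal $\pi$-calculus are $P ::= 0 \mid P|P \mid \nu a\,P \mid a(\tilde b).P \mid \bar a(\tilde b).P \mid {!}a(\tilde b).P \mid K\langle\tilde a\rangle$, where outputs are bound (the names in $\tilde b$ are pairwise distinct and bound in $P$) and the constants $K$ are the two forwarders, defined by mutual recursion for value names and for continuation names: $$x \triangleright y = {!}x(z,q).\bar y(z',q').(z' \triangleright z \mid q' \triangleright q), \qquad p \triangleright q = p(x).\bar q(y).(y \triangleright x).$$ $\xrightarrow{\mu}$ is the usual labelled transition system (labels $\tau$, $a(\tilde b)$, $\bar a(\tilde b)$); ${\Rightarrow}$ is $\xrightarrow{\tau}{}^{*}$ and $\stackrel{\mu}{\Rightarrow}$ is $\Rightarrow\xrightarrow{\mu}\Rightarrow$. A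 relation $\mathcal R$ is an expansion relation if $P\,\mathcal R\,Q$ implies: (1) whenever $P\xrightarrow{\mu}P'$, there is $Q'$ with $P'\,\mathcal R\,Q'$ and either $Q\xrightarrow{\mu}Q'$, or $\mu=\tau$ and $Q'=Q$; (2) whenever $Q\xrightarrow{\mu}Q'$, there is $P'$ with $P\stackrel{\mu}{\Rightarrow}P'$ and $P'\,\mathcal R\,Q'$. We write $P\succeq Q$ ($P$ expands $Q$) if $P\,\mathcal R\,Q$ for some expansion relation $\mathcal R$. \emph{Optimised encoding.} Let $\lambda$-variables be names, and let $p,q,r$ (continuation names) be distinct from all $\lambda$-variables. Bound names are chosen fresh. Put $W = \bar y(w',r').(w'\triangleright w \mid r'\triangleright p)$. For values, $[\![x]\!]^{v}_y = y\triangleright x$, $[\![\lambda x.M]\!]^{v}_y = {!}y(x,q).[\![M]\!]_q$ and $[\![V]\!]_p = \bar p(y).[\![V]\!]^{v}_y$. For applications, where $V,V'$ are values and $M,N$ are not values unless under a $\lambda$, $$\begin{aligned} [\![x\,V]\!]_p &= \bar x(z,q).([\![V]\!]^{v}_z \mid q\triangleright p),\\ [\![(\lambda x.M)\,V]\!]_p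 &= \nu y\,\nu w\,([\![\lambda x.M]\!]^{v}_y \mid [\![V]\!]^{v}_w \mid W),\\ [\![V\,N]\!]_p &= \nu y\,([\![V]\!]^{v}_y \mid \nu r\,([\![N]\!]_r \mid r(w).W)),\\ [\![M\,V]\!]_p &= \nu q\,([\![M]\!]_q \mid q(y).\nu w\,([\![V]\!]^{v}_w \mid W)),\\ [\![M\,N]\!]_p &= \nu q\,([\![M]\!]_q \mid q(y).\nu r\,([\![N]\!]_r \mid r(w).W)). \end{aligned}$$ \emph{Statement.} If $M\to N$, then for every continuation name $p$ there is a process $P$ such that $[\![M]\!]_p \xrightarrow{\tau} P$ and $P \succeq [\![N]\!]_p$; moreover $[\![M]\!]_p \succeq [\![N]\!]_p$. -/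

import Mathlib

namespace CbvPiI

/-! ## The untyped call-by-value lambda-calculus (de Bruijn indices) -/

/-- Lambda-terms, open terms included. -/
inductive Term : Type where
  | var (x : ℕ) : Term
  | lam (M : Term) : Term
  | app (M N : Term) : Term

namespace Term

/-- Values are the variables and the abstractions. -/
def isValue : Term → Bool
  | var _ => true
  | lam _ => true
  | app _ _ => false

/-- Lifting of a renaming under one binder. -/
def upr (f : ℕ → ℕ) : ℕ → ℕ
  | 0 => 0
  | i + 1 => f i + 1

def rename : Term → (ℕ → ℕ) → Term
  | var x, f => var (f x)
  | lam M, f => lam (M.rename (upr f))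
  | app M N, f => app (M.rename f) (N.rename f)

/-- Lifting of a substitution under one binder. -/
def ups (s : ℕ → Term) : ℕ → Term
  | 0 => var 0
  | i + 1 => (s i).rename Nat.succ

/-- Capture-avoiding simultaneous substitution. -/
def subst : Term → (ℕ → Term) → Term
  | var x, s => s x
  | lam M, s => lam (M.subst (ups s))
  | app M N, s => app (M.subst s) (N.subst s)

/-- `M.inst V` is `M{V/x}`, where `x` is the variable with index `0`. -/
def inst (M V : Term) : Term :=
  M.subst fun i => match i with
    | 0 => V
    | j + 1 => var j

end Term

/-- Call-by-value evaluation contexts `E ::= [·] | V E | E M`. -/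
inductive EvCtx : Type where
  | hole : EvCtx
  | appR (V : Term) (hV : V.isValue) (E : EvCtx) : EvCtx
  | appL (E : EvCtx) (M : Term) : EvCtx

/-- `E.fill M` is `E[M]`. -/
def EvCtx.fill : EvCtx → Term → Term
  | hole, M => M
  | appR V _ E, M => .app V (E.fill M)
  | appL E L, M => .app (E.fill M) L

/-- One step of beta_v-reduction: `E[(λx.M)V] ⟶ E[M{V/x}]`. -/
inductive BetaV : Term → Term → Prop where
  | step (E : EvCtx) (M V : Term) (hV : V.isValue) :
      BetaV (E.fill (.app (.lam M) V)) (E.fill (M.inst V))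

/-! ## The polyadic internal pi-calculus (de Bruijn indices)

A prefix `inp a n P`, `out a n P` or `rep a n P` binds in `P` the `n` pairwise distinct names
with indices `0, …, n-1` (its objects `b₁, …, bₙ`, in this order), and a name that is `i` outside
is `i + n` in `P`. -/

abbrev Name := ℕ

/-- The two process constants, the forwarders for value names and for continuation names. -/
inductive Link : Type where
  | val : Link
  | cont : Link

/-- Processes. -/
inductive Proc : Type where
  | nil : Proc
  | par (P Q : Proc) : Proc
  /-- `ν a P`, with `a` the index `0` in `P`. -/
  | nu (P : Proc) : Proc
  /-- `a(b₁,…,bₙ).P` -/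
  | inp (a : Name) (n : ℕ) (P : Proc) : Proc
  /-- the bound output `ā(b₁,…,bₙ).P` -/
  | out (a : Name) (n : ℕ) (P : Proc) : Proc
  /-- `!a(b₁,…,bₙ).P` -/
  | rep (a : Name) (n : ℕ) (P : Proc) : Proc
  /-- the constant `k` applied to two names: the forwarder `a ▷ b`. -/
  | link (k : Link) (a b : Name) : Proc

namespace Proc

/-- Lifting of a renaming under `n` binders. -/
def liftN (n : ℕ) (f : Name → Name) (i : Name) : Name :=
  if i < n then i else f (i - n) + n

def rename : Proc → (Name → Name) → Proc
  | nil, _ => nil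
  | par P Q, f => par (P.rename f) (Q.rename f)
  | nu P, f => nu (P.rename (liftN 1 f))
  | inp a n P, f => inp (f a) n (P.rename (liftN n f))
  | out a n P, f => out (f a) n (P.rename (liftN n f))
  | rep a n P, f => rep (f a) n (P.rename (liftN n f))
  | link k a b, f => link k (f a) (f b)

/-- Weakening of a process by `n` new names `0, …, n-1`. -/
def shift (n : ℕ) (P : Proc) : Proc := P.rename (· + n)

/-- Restriction of the names `0, …, n-1`. -/
def nuN : ℕ → Proc → Proc
  | 0, P => P
  | n + 1, P => nuN n (nu P)

end Proc

/-- The defining (mutually recursive) equations of the forwarders: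
`x ▷ y = !x(z,q).ȳ(z',q').(z' ▷ z | q' ▷ q)` for value names,
`p ▷ q = p(x).q̄(y).(y ▷ x)` for continuation names. -/
def Link.body : Link → Name → Name → Proc
  | .val, x, y => .rep x 2 (.out (y + 2) 2 (.par (.link .val 0 2) (.link .cont 1 3)))
  | .cont, p, q => .inp p 1 (.out (q + 1) 1 (.link .val 0 1))

/-- Actions: `τ`, the input `a(b₁,…,bₙ)` and the bound output `ā(b₁,…,bₙ)`. The objects are
fresh; in the derivative they are the indices `0, …, n-1`. -/
inductive Act : Type where
  | tau : Act
  | inp (a : Name) (n : ℕ) : Act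
  | out (a : Name) (n : ℕ) : Act

namespace Act

/-- The number of names that an action binds. -/
def bn : Act → ℕ
  | tau => 0
  | inp _ n => n
  | out _ n => n

def rename : Act → (Name → Name) → Act
  | tau, _ => tau
  | inp a n, f => inp (f a) n
  | out a n, f => out (f a) n

end Act

/-- Exchanges the block of names `0, …, n-1` with the name `n` following it. -/
def rot (n : ℕ) (i : Name) : Name :=
  if i < n then i + 1 else if i = n then 0 else i

/-- The labelled transition system. A name `i` of the source is `i + μ.bn` in the derivative. -/
inductive Trans : Proc → Act → Proc → Prop where
  | inp (a : Name) (n : ℕ) (P : Proc) : Trans (.inp a n P) (.inp a n) P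
  | out (a : Name) (n : ℕ) (P : Proc) : Trans (.out a n P) (.out a n) P
  | rep (a : Name) (n : ℕ) (P : Proc) :
      Trans (.rep a n P) (.inp a n) (.par P ((Proc.rep a n P).shift n))
  | parL {P P' : Proc} {μ : Act} (Q : Proc) (h : Trans P μ P') :
      Trans (.par P Q) μ (.par P' (Q.shift μ.bn))
  | parR {Q Q' : Proc} {μ : Act} (P : Proc) (h : Trans Q μ Q') :
      Trans (.par P Q) μ (.par (P.shift μ.bn) Q')
  | comL {P P' Q Q' : Proc} {a : Name} {n : ℕ}
      (hP : Trans P (.out a n) P') (hQ : Trans Q (.inp a n) Q') :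
      Trans (.par P Q) .tau (.nuN n (.par P' Q'))
  | comR {P P' Q Q' : Proc} {a : Name} {n : ℕ}
      (hP : Trans P (.inp a n) P') (hQ : Trans Q (.out a n) Q') :
      Trans (.par P Q) .tau (.nuN n (.par P' Q'))
  /-- The premise says that the restricted name `0` is not the subject of the action. -/
  | res {P P' : Proc} {μ : Act} (h : Trans P (μ.rename Nat.succ) P') :
      Trans (.nu P) μ (.nu (P'.rename (rot μ.bn)))
  | const {k : Link} {a b : Name} {μ : Act} {P' : Proc} (h : Trans (k.body a b) μ P') :
      Trans (.link k a b) μ P'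

/-- `P ⟹ P'`: any number of `τ`-steps. -/
def TauStar : Proc → Proc → Prop := Relation.ReflTransGen fun P P' => Trans P .tau P'

/-- `P ⟹ -μ→ ⟹ P'`; for `μ = τ` this is at least one `τ`-step. -/
def WeakTrans (P : Proc) (μ : Act) (P' : Proc) : Prop :=
  ∃ P₁ P₂, TauStar P P₁ ∧ Trans P₁ μ P₂ ∧ TauStar P₂ P'

/-- `P -μ→ P'`, or `μ = τ` and `P' = P`. -/
def OptTrans (P : Proc) (μ : Act) (P' : Proc) : Prop :=
  Trans P μ P' ∨ (μ = .tau ∧ P' = P)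

/-- Expansion relations. -/
def IsExpansion (R : Proc → Proc → Prop) : Prop :=
  ∀ P Q, R P Q →
    (∀ μ P', Trans P μ P' → ∃ Q', OptTrans Q μ Q' ∧ R P' Q') ∧
    (∀ μ Q', Trans Q μ Q' → ∃ P', WeakTrans P μ P' ∧ R P' Q')

/-- `P` expands `Q`. -/
def Expands (P Q : Proc) : Prop := ∃ R, IsExpansion R ∧ R P Q

/-! ## The optimised encoding -/

/-- `ȳ(w',r').(w' ▷ w | r' ▷ p)` -/
def sendTo (y w p : Name) : Proc :=
  .out y 2 (.par (.link .val 0 (w + 2)) (.link .cont 1 (p + 2)))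

/-- An assignment of names to the lambda-variables. -/
abbrev Env := ℕ → Name

/-- The same assignment, below `k` further bound names. -/
def Env.up (ρ : Env) (k : ℕ) : Env := fun i => ρ i + k

/-- Below the prefix `y(x,q)` the lambda-variable with index `0` is the name `x`. -/
def Env.bind (ρ : Env) : Env
  | 0 => 0
  | i + 1 => ρ i + 2

/-- `term`: encoding of a term at a continuation name.
`value`: auxiliary encoding of a value at a value name. -/
inductive Mode : Type where
  | term : Mode
  | value : Mode

/-- The optimised encoding and its auxiliary encoding of values, by a single recursion.
The auxiliary encoding is only ever used on values; on applications it is set to `nil`. -/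
def enc : Term → Mode → Env → Name → Proc
  | .var x, .value, ρ, y => .link .val y (ρ x)
  | .var x, .term, ρ, p => .out p 1 (.link .val 0 (ρ x + 1))
  | .lam M, .value, ρ, y => .rep y 2 (enc M .term ρ.bind 1)
  | .lam M, .term, ρ, p => .out p 1 (.rep 0 2 (enc M .term (ρ.up 1).bind 1))
  | .app _ _, .value, _, _ => .nil
  | .app M N, .term, ρ, p =>
    match M, N.isValue with
    | .var x, true =>
        .out (ρ x) 2 (.par (enc N .value (ρ.up 2) 0) (.link .cont 1 (p + 2)))
    | .lam _, true =>
        .nu (.nu (.par (enc M .value (ρ.up 2) 1)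
          (.par (enc N .value (ρ.up 2) 0) (sendTo 1 0 (p + 2)))))
    | .app _ _, true =>
        .nu (.par (enc M .term (ρ.up 1) 0)
          (.inp 0 1 (.nu (.par (enc N .value (ρ.up 3) 0) (sendTo 1 0 (p + 3))))))
    | .app _ _, false =>
        .nu (.par (enc M .term (ρ.up 1) 0)
          (.inp 0 1 (.nu (.par (enc N .term (ρ.up 3) 0) (.inp 0 1 (sendTo 2 0 (p + 4)))))))
    | _, false =>
        .nu (.par (enc M .value (ρ.up 1) 0)
          (.nu (.par (enc N .term (ρ.up 2) 0) (.inp 0 1 (sendTo 2 0 (p + 3))))))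

/-- The optimised encoding `⟦M⟧p` of the term `M` at the continuation name `p`. -/
def optEnc (M : Term) (ρ : Env) (p : Name) : Proc := enc M .term ρ p

/-- The auxiliary encoding `⟦V⟧ᵥ y` of the value `V` at the value name `y`. -/
def optEncVal (V : Term) (ρ : Env) (y : Name) : Proc := enc V .value ρ y

/-! The clauses of the encoding. -/

/-- `⟦x⟧ᵥ y = y ▷ x` -/
theorem optEncVal_var (x : ℕ) (ρ : Env) (y : Name) :
    optEncVal (.var x) ρ y = .link .val y (ρ x) := rfl

/-- `⟦λx.M⟧ᵥ y = !y(x,q).⟦M⟧q` -/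
theorem optEncVal_lam (M : Term) (ρ : Env) (y : Name) :
    optEncVal (.lam M) ρ y = .rep y 2 (optEnc M ρ.bind 1) := rfl

/-- `⟦V⟧p = p̄(y).⟦V⟧ᵥ y` -/
theorem optEnc_value {V : Term} (hV : V.isValue) (ρ : Env) (p : Name) :
    optEnc V ρ p = .out p 1 (optEncVal V (ρ.up 1) 0) := by
  cases V with
  | var x => rfl
  | lam M => rfl
  | app M N => simp [Term.isValue] at hV

/-- `⟦x V⟧p = x̄(z,q).(⟦V⟧ᵥ z | q ▷ p)` -/
theorem optEnc_var_value (x : ℕ) {V : Term} (hV : V.isValue) (ρ : Env) (p : Name) :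
    optEnc (.app (.var x) V) ρ p =
      .out (ρ x) 2 (.par (optEncVal V (ρ.up 2) 0) (.link .cont 1 (p + 2))) := by
  simp [optEnc, optEncVal, enc, hV]

/-- `⟦(λx.M) V⟧p = ν y,w (⟦λx.M⟧ᵥ y | ⟦V⟧ᵥ w | ȳ(w',r').(w' ▷ w | r' ▷ p))` -/
theorem optEnc_lam_value (M : Term) {V : Term} (hV : V.isValue) (ρ : Env) (p : Name) :
    optEnc (.app (.lam M) V) ρ p =
      .nu (.nu (.par (optEncVal (.lam M) (ρ.up 2) 1)
        (.par (optEncVal V (ρ.up 2) 0) (sendTo 1 0 (p + 2))))) := by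
  simp [optEnc, optEncVal, enc, hV]

/-- `⟦V N⟧p = ν y (⟦V⟧ᵥ y | ν r (⟦N⟧r | r(w).ȳ(w',r').(w' ▷ w | r' ▷ p)))`,
`N` not a value -/
theorem optEnc_value_app {V N : Term} (hV : V.isValue) (hN : N.isValue = false)
    (ρ : Env) (p : Name) :
    optEnc (.app V N) ρ p =
      .nu (.par (optEncVal V (ρ.up 1) 0)
        (.nu (.par (optEnc N (ρ.up 2) 0) (.inp 0 1 (sendTo 2 0 (p + 3)))))) := by
  cases V with
  | var x => simp [optEnc, optEncVal, enc, hN]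
  | lam M => simp [optEnc, optEncVal, enc, hN]
  | app M N => simp [Term.isValue] at hV

/-- `⟦M V⟧p = ν q (⟦M⟧q | q(y).ν w (⟦V⟧ᵥ w | ȳ(w',r').(w' ▷ w | r' ▷ p)))`,
`M` not a value -/
theorem optEnc_app_value {M V : Term} (hM : M.isValue = false) (hV : V.isValue)
    (ρ : Env) (p : Name) :
    optEnc (.app M V) ρ p =
      .nu (.par (optEnc M (ρ.up 1) 0)
        (.inp 0 1 (.nu (.par (optEncVal V (ρ.up 3) 0) (sendTo 1 0 (p + 3)))))) := by
  cases M with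
  | var x => simp [Term.isValue] at hM
  | lam M => simp [Term.isValue] at hM
  | app M N => simp only [optEnc, optEncVal, enc, hV]

/-- `⟦M N⟧p = ν q (⟦M⟧q | q(y).ν r (⟦N⟧r | r(w).ȳ(w',r').(w' ▷ w | r' ▷ p)))`,
neither `M` nor `N` a value -/
theorem optEnc_app_app {M N : Term} (hM : M.isValue = false) (hN : N.isValue = false)
    (ρ : Env) (p : Name) :
    optEnc (.app M N) ρ p =
      .nu (.par (optEnc M (ρ.up 1) 0)
        (.inp 0 1 (.nu (.par (optEnc N (ρ.up 3) 0) (.inp 0 1 (sendTo 2 0 (p + 4))))))) := by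
  cases M with
  | var x => simp [Term.isValue] at hM
  | lam M => simp [Term.isValue] at hM
  | app M N => simp only [optEnc, enc, hN]

end CbvPiI

/-! The communication at `y` in the encoding of `(λx.M) V` leaves, after garbage collection of `y`,
the process `νw (⟦V⟧ᵥ w | νw' νr' (w' ▷ w | r' ▷ p | ⟦M⟧r'))`, with `w'` in the role of `x`. Both
forwarders must be absorbed.

The continuation forwarder is absorbed by `Continues`. In every clause for an application `p` occurs
only as the target of a forwarder, so a chain of two forwarders has to collapse
(`Expands.link_trans`); the clause for values needs `Forwards`. The forwarder `w' ▷ w` together with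
`⟦V⟧ᵥ w` is a `server` for `V`. `Substitutes` pushes this server through `⟦M⟧p` until it meets the
occurrences of `x`; at a call `x U` it needs `Forwards` for the substituted argument. Conversely
`Forwards (λx.M)` needs `Continues M` and `Substitutes` for a variable. The circle is cut by
induction on size, since replacing variables by variables preserves size (`forwards_of_isValue`);
substitution of arbitrary values then follows.

On the side of processes, `Cong` collects the structural laws, among them distribution and copying
of restricted servers, and is a strong bisimulation. Expansions are proved up to contexts, expansion
on the left and `Cong` on the right (`UpTo.expands`), which also makes expansion a precongruence.

Evaluation contexts need more than congruence: a reduct may become a value, and then a different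
clause of the encoding applies. The `_context` lemmas bridge the two clauses. -/

namespace CbvPiI

/-! ## Renamings -/

namespace Proc

theorem liftN_zero (f : Name → Name) : liftN 0 f = f := by
  funext i; simp [liftN]

theorem liftN_id (n : ℕ) : liftN n id = id := by
  funext i; simp only [liftN, id]; grind

theorem liftN_comp (n : ℕ) (g f : Name → Name) : liftN n g ∘ liftN n f = liftN n (g ∘ f) := by
  funext i; by_cases h : i < n <;> simp [liftN, h]

theorem liftN_one_liftN (n : ℕ) (f : Name → Name) : liftN 1 (liftN n f) = liftN (n + 1) f := by
  funext i; simp only [liftN]; grind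

theorem liftN_injective (n : ℕ) {f : Name → Name} (hf : f.Injective) : (liftN n f).Injective := by
  intro i j h
  have := @hf (i - n) (j - n)
  simp only [liftN] at h
  grind

theorem liftN_comp_add (n : ℕ) (f : Name → Name) : liftN n f ∘ (· + n) = (· + n) ∘ f := by
  funext i; simp [liftN]

theorem rename_id (P : Proc) : P.rename id = P := by
  induction P <;> simp_all [rename, liftN_id]

theorem rename_rename (P : Proc) (f g : Name → Name) :
    (P.rename f).rename g = P.rename (g ∘ f) := by
  induction P generalizing f g <;> simp_all [rename, liftN_comp]

theorem rename_eq_self (P : Proc) {f : Name → Name} (h : ∀ i, f i = i) : P.rename f = P := by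
  rw [show f = id from funext h, rename_id]

theorem shift_zero (P : Proc) : P.shift 0 = P := P.rename_eq_self fun _ => rfl

theorem shift_rename_liftN (P : Proc) (n : ℕ) (f : Name → Name) :
    (P.shift n).rename (liftN n f) = (P.rename f).shift n := by
  simp only [shift, rename_rename, liftN_comp_add]

theorem nuN_rename (n : ℕ) (P : Proc) (f : Name → Name) :
    (nuN n P).rename f = nuN n (P.rename (liftN n f)) := by
  induction n generalizing P f with
  | zero => simp [nuN, liftN_zero]
  | succ n ih => simp [nuN, ih, rename, liftN_one_liftN]

end Proc

open Proc

/-- As `rot n` brings the name `n` to the front, this and the next identities let a restriction pass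
the names bound by an action. -/
theorem rot_comp_liftN_liftN (n : ℕ) (f : Name → Name) :
    rot n ∘ liftN n (liftN 1 f) = liftN 1 (liftN n f) ∘ rot n := by
  funext i; simp only [rot, liftN, Function.comp]; grind

theorem rot_comp_add (n : ℕ) : rot n ∘ (· + n) = liftN 1 (· + n) := by
  funext i; simp only [rot, liftN, Function.comp]; grind

theorem rot_comp_liftN_succ (n : ℕ) : rot n ∘ liftN n Nat.succ = Nat.succ := by
  funext i; simp only [rot, liftN, Function.comp]; grind

theorem rot_zero : rot 0 = id := by
  funext i; simp only [rot, id]; grind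

theorem rot_injective (n : ℕ) : (rot n).Injective := by
  intro i j; simp only [rot]; grind

theorem rot_eq_zero_iff {n i : ℕ} : rot n i = 0 ↔ i = n := by
  simp only [rot]; grind

theorem rename_rot_zero (P : Proc) : P.rename (rot 0) = P := by rw [rot_zero, rename_id]

theorem shift_rename_rot (P : Proc) (n : ℕ) :
    (P.shift n).rename (rot n) = P.rename (liftN 1 (· + n)) := by
  rw [shift, rename_rename, rot_comp_add]

theorem add_injective (n : ℕ) : (fun i : Name => i + n).Injective := fun _ _ => Nat.add_right_cancel

namespace Act

@[simp] theorem bn_rename (μ : Act) (f : Name → Name) : (μ.rename f).bn = μ.bn := by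
  cases μ <;> rfl

theorem rename_rename (μ : Act) (f g : Name → Name) :
    (μ.rename f).rename g = μ.rename (g ∘ f) := by
  cases μ <;> rfl

theorem rename_injective {f : Name → Name} (hf : f.Injective) {μ ν : Act}
    (h : μ.rename f = ν.rename f) : μ = ν := by
  cases μ <;> cases ν <;> simp_all [rename, hf.eq_iff]

theorem rename_eq_tau {μ : Act} {f : Name → Name} : μ.rename f = tau ↔ μ = tau := by
  cases μ <;> simp [rename]

/-- An action whose image under `liftN 1 f` avoids the name `0` avoids it. -/
theorem eq_rename_succ_of_rename_liftN {μ ν : Act} {f : Name → Name}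
    (h : μ.rename Nat.succ = ν.rename (liftN 1 f)) :
    ∃ κ : Act, ν = κ.rename Nat.succ ∧ μ = κ.rename f := by
  cases μ with
  | tau => exact ⟨.tau, by cases ν <;> simp_all [rename], rfl⟩
  | inp a n =>
    cases ν with
    | inp b m =>
      cases b with
      | zero => simp [rename, liftN] at h
      | succ b => exact ⟨.inp b m, rfl, by simpa [rename, liftN] using h⟩
    | _ => simp [rename] at h
  | out a n =>
    cases ν with
    | out b m =>
      cases b with
      | zero => simp [rename, liftN] at h
      | succ b => exact ⟨.out b m, rfl, by simpa [rename, liftN] using h⟩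
    | _ => simp [rename] at h

end Act

theorem Link.body_rename (k : Link) (a b : Name) (f : Name → Name) :
    (k.body a b).rename f = k.body (f a) (f b) := by
  cases k <;> simp [Link.body, Proc.rename, liftN]

/-! ## Transitions: renaming and inversion -/

theorem Trans.rename {P P' : Proc} {μ : Act} (h : Trans P μ P') (f : Name → Name) :
    Trans (P.rename f) (μ.rename f) (P'.rename (liftN μ.bn f)) := by
  induction h generalizing f with
  | inp a n P => exact .inp _ _ _
  | out a n P => exact .out _ _ _
  | rep a n P =>
    have := Trans.rep (f a) n (P.rename (liftN n f))
    rw [show Proc.rep (f a) n (P.rename (liftN n f)) = (Proc.rep a n P).rename f from rfl,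
      ← shift_rename_liftN] at this
    exact this
  | parL Q h ih =>
    have := Trans.parL (Q.rename f) (ih f)
    rw [Act.bn_rename, ← shift_rename_liftN] at this
    exact this
  | parR P h ih =>
    have := Trans.parR (P.rename f) (ih f)
    rw [Act.bn_rename, ← shift_rename_liftN] at this
    exact this
  | comL hP hQ ihP ihQ =>
    have := Trans.comL (ihP f) (ihQ f)
    simpa [Act.bn, Act.rename, liftN_zero, nuN_rename, Proc.rename] using this
  | comR hP hQ ihP ihQ =>
    have := Trans.comR (ihP f) (ihQ f)
    simpa [Act.bn, Act.rename, liftN_zero, nuN_rename, Proc.rename] using this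
  | @res P P' μ h ih =>
    have h1 := ih (liftN 1 f)
    rw [Act.rename_rename, show liftN 1 f ∘ Nat.succ = Nat.succ ∘ f from liftN_comp_add 1 f,
      ← Act.rename_rename, Act.bn_rename] at h1
    have := Trans.res h1
    rw [Act.bn_rename, Proc.rename_rename, rot_comp_liftN_liftN, ← Proc.rename_rename] at this
    exact this
  | @const k a b μ P' h ih =>
    have := ih f
    rw [Link.body_rename] at this
    exact .const this

theorem Trans.of_rename {P X : Proc} {ν : Act} {f : Name → Name} (hf : f.Injective)
    (h : Trans (P.rename f) ν X) :
    ∃ μ P', ν = μ.rename f ∧ X = P'.rename (liftN μ.bn f) ∧ Trans P μ P' := by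
  generalize hQ : P.rename f = Q at h
  induction h generalizing P f with
  | inp a n Q =>
    cases P <;> simp [Proc.rename] at hQ
    obtain ⟨rfl, rfl, rfl⟩ := hQ
    exact ⟨.inp _ _, _, rfl, rfl, .inp _ _ _⟩
  | out a n Q =>
    cases P <;> simp [Proc.rename] at hQ
    obtain ⟨rfl, rfl, rfl⟩ := hQ
    exact ⟨.out _ _, _, rfl, rfl, .out _ _ _⟩
  | rep a n Q =>
    cases P <;> simp [Proc.rename] at hQ
    obtain ⟨rfl, rfl, rfl⟩ := hQ
    refine ⟨.inp _ _, _, rfl, ?_, .rep _ _ _⟩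
    simp [Proc.rename, Act.bn, shift_rename_liftN]
  | parL Q h ih =>
    cases P <;> simp [Proc.rename] at hQ
    obtain ⟨rfl, rfl⟩ := hQ
    obtain ⟨μ, P', rfl, rfl, h'⟩ := ih hf rfl
    refine ⟨μ, _, rfl, ?_, .parL _ h'⟩
    simp [Proc.rename, shift_rename_liftN]
  | parR Q h ih =>
    cases P <;> simp [Proc.rename] at hQ
    obtain ⟨rfl, rfl⟩ := hQ
    obtain ⟨μ, P', rfl, rfl, h'⟩ := ih hf rfl
    refine ⟨μ, _, rfl, ?_, .parR _ h'⟩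
    simp [Proc.rename, shift_rename_liftN]
  | comL hP hQ' ihP ihQ =>
    cases P <;> simp [Proc.rename] at hQ
    obtain ⟨rfl, rfl⟩ := hQ
    obtain ⟨μ, P', h1, rfl, h2⟩ := ihP hf rfl
    obtain ⟨ν, Q', h3, rfl, h4⟩ := ihQ hf rfl
    cases μ <;> simp [Act.rename] at h1
    cases ν <;> simp [Act.rename] at h3
    obtain ⟨rfl, rfl⟩ := h1
    obtain ⟨h3, rfl⟩ := h3
    cases hf h3
    refine ⟨.tau, _, rfl, ?_, .comL h2 h4⟩
    simp [Act.bn, liftN_zero, nuN_rename, Proc.rename]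
  | comR hP hQ' ihP ihQ =>
    cases P <;> simp [Proc.rename] at hQ
    obtain ⟨rfl, rfl⟩ := hQ
    obtain ⟨μ, P', h1, rfl, h2⟩ := ihP hf rfl
    obtain ⟨ν, Q', h3, rfl, h4⟩ := ihQ hf rfl
    cases μ <;> simp [Act.rename] at h1
    cases ν <;> simp [Act.rename] at h3
    obtain ⟨rfl, rfl⟩ := h1
    obtain ⟨h3, rfl⟩ := h3
    cases hf h3
    refine ⟨.tau, _, rfl, ?_, .comR h2 h4⟩
    simp [Act.bn, liftN_zero, nuN_rename, Proc.rename]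
  | res h ih =>
    cases P <;> simp [Proc.rename] at hQ
    subst hQ
    obtain ⟨ν, P', h1, rfl, h2⟩ := ih (liftN_injective 1 hf) rfl
    obtain ⟨κ, rfl, rfl⟩ := Act.eq_rename_succ_of_rename_liftN h1
    refine ⟨κ, _, rfl, ?_, .res h2⟩
    simp only [Proc.rename, Act.bn_rename, Proc.rename_rename, rot_comp_liftN_liftN]
  | const h ih =>
    cases P <;> simp [Proc.rename] at hQ
    obtain ⟨rfl, rfl, rfl⟩ := hQ
    obtain ⟨μ, P', rfl, rfl, h'⟩ := ih hf (Link.body_rename _ _ _ _)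
    exact ⟨μ, P', rfl, rfl, .const h'⟩

/-- Inversion for parallel compositions, for an arbitrary action. -/
theorem Trans.par_inv {P Q X : Proc} {μ : Act} (h : Trans (.par P Q) μ X) :
    (∃ P', Trans P μ P' ∧ X = .par P' (Q.shift μ.bn)) ∨
    (∃ Q', Trans Q μ Q' ∧ X = .par (P.shift μ.bn) Q') ∨
    (μ = .tau ∧ ∃ a n P' Q', Trans P (.out a n) P' ∧ Trans Q (.inp a n) Q' ∧
      X = nuN n (.par P' Q')) ∨
    (μ = .tau ∧ ∃ a n P' Q', Trans P (.inp a n) P' ∧ Trans Q (.out a n) Q' ∧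
      X = nuN n (.par P' Q')) := by
  cases h with
  | parL _ h => exact .inl ⟨_, h, rfl⟩
  | parR _ h => exact .inr (.inl ⟨_, h, rfl⟩)
  | comL hP hQ => exact .inr (.inr (.inl ⟨rfl, _, _, _, _, hP, hQ, rfl⟩))
  | comR hP hQ => exact .inr (.inr (.inr ⟨rfl, _, _, _, _, hP, hQ, rfl⟩))

theorem Trans.nu_inv {P X : Proc} {μ : Act} (h : Trans (.nu P) μ X) :
    ∃ P', Trans P (μ.rename Nat.succ) P' ∧ X = .nu (P'.rename (rot μ.bn)) := by
  cases h with
  | res h => exact ⟨_, h, rfl⟩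

theorem Trans.inp_inv {a : Name} {n : ℕ} {P X : Proc} {μ : Act} (h : Trans (.inp a n P) μ X) :
    μ = .inp a n ∧ X = P := by
  cases h; exact ⟨rfl, rfl⟩

theorem Trans.out_inv {a : Name} {n : ℕ} {P X : Proc} {μ : Act} (h : Trans (.out a n P) μ X) :
    μ = .out a n ∧ X = P := by
  cases h; exact ⟨rfl, rfl⟩

theorem Trans.rep_inv {a : Name} {n : ℕ} {P X : Proc} {μ : Act} (h : Trans (.rep a n P) μ X) :
    μ = .inp a n ∧ X = .par P ((Proc.rep a n P).shift n) := by
  cases h; exact ⟨rfl, rfl⟩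

theorem Trans.link_inv {k : Link} {a b : Name} {X : Proc} {μ : Act}
    (h : Trans (.link k a b) μ X) : Trans (k.body a b) μ X := by
  cases h; assumption

theorem Trans.nil_inv {X : Proc} {μ : Act} (h : Trans .nil μ X) : False := by
  cases h

/-- `τ`-transitions of a restriction. -/
theorem Trans.res_tau {P P' : Proc} (h : Trans P .tau P') : Trans (.nu P) .tau (.nu P') := by
  have := Trans.res (μ := .tau) h
  rwa [Act.bn, rename_rot_zero] at this

end CbvPiI

/-! ### Structural and replication laws as a strong bisimulation. -/

namespace CbvPiI

open Proc

/-! ## Static conditions -/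

/-- Every transition of the process is an input at the name `0`. -/
def Inert (Q : Proc) : Prop := ∀ μ Q', Trans Q μ Q' → ∃ m, μ = .inp 0 m

theorem Inert.nil : Inert .nil := fun _ _ h => h.nil_inv.elim

theorem Inert.rep (n : ℕ) (P : Proc) : Inert (.rep 0 n P) := fun _ _ h => ⟨n, h.rep_inv.1⟩

theorem Inert.link (k : Link) (b : Name) : Inert (.link k 0 b) := by
  intro μ Q' h
  cases k
  · exact ⟨_, h.link_inv.rep_inv.1⟩
  · exact ⟨_, h.link_inv.inp_inv.1⟩

/-- The name `k` is not the subject of any input prefix. -/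
def NoInp : Name → Proc → Prop
  | _, .nil => True
  | k, .par P Q => NoInp k P ∧ NoInp k Q
  | k, .nu P => NoInp (k + 1) P
  | k, .inp a n P => a ≠ k ∧ NoInp (k + n) P
  | k, .out _ n P => NoInp (k + n) P
  | k, .rep a n P => a ≠ k ∧ NoInp (k + n) P
  | k, .link _ a _ => a ≠ k

theorem liftN_eq_add {n : ℕ} {f : Name → Name} {k l i : Name} (hf : ∀ i, f i = l → i = k)
    (h : liftN n f i = l + n) : i = k + n := by
  have := hf (i - n)
  simp only [liftN] at h
  grind

theorem NoInp.rename {P : Proc} {f : Name → Name} {k l : Name} (h : NoInp k P)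
    (hf : ∀ i, f i = l → i = k) : NoInp l (P.rename f) := by
  induction P generalizing f k l with
  | nil => trivial
  | par P Q ihP ihQ => exact ⟨ihP h.1 hf, ihQ h.2 hf⟩
  | nu P ih => exact ih (k := k + 1) h fun i => liftN_eq_add hf
  | inp a n P ih => exact ⟨fun e => h.1 (hf _ e), ih (k := k + n) h.2 fun i => liftN_eq_add hf⟩
  | out a n P ih => exact ih (k := k + n) h fun i => liftN_eq_add hf
  | rep a n P ih => exact ⟨fun e => h.1 (hf _ e), ih (k := k + n) h.2 fun i => liftN_eq_add hf⟩
  | link c a b => exact fun e => h (hf _ e)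

theorem NoInp.shift {P : Proc} {k : Name} (h : NoInp k P) (n : ℕ) : NoInp (k + n) (P.shift n) :=
  h.rename fun _ => Nat.add_right_cancel

theorem NoInp.rename_rot {P : Proc} {n : ℕ} (h : NoInp n P) : NoInp 0 (P.rename (rot n)) :=
  h.rename fun _ => rot_eq_zero_iff.1

theorem NoInp.nuN {P : Proc} {k : Name} {n : ℕ} : NoInp k (nuN n P) ↔ NoInp (k + n) P := by
  induction n generalizing P with
  | zero => rfl
  | succ n ih => exact ih.trans (by rw [NoInp, Nat.add_assoc])

theorem NoInp.body {c : Link} {k a b : Name} (h : a ≠ k) : NoInp k (c.body a b) := by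
  cases c <;> simp [Link.body, NoInp, h]

/-- Mobility is internal: the objects of an action are always fresh, so no known name is ever
substituted into the subject of an input. A forwarder inputs only at its first argument and at names
it binds itself. -/
theorem NoInp.trans {P P' : Proc} {μ : Act} {k : Name} (h : NoInp k P) (t : Trans P μ P') :
    (∀ n, μ ≠ .inp k n) ∧ NoInp (k + μ.bn) P' := by
  induction t generalizing k with
  | inp a n P => exact ⟨fun m e => h.1 (by cases e; rfl), h.2⟩
  | out a n P => exact ⟨by simp, h⟩
  | rep a n P => exact ⟨fun m e => h.1 (by cases e; rfl), h.2, NoInp.shift (P := .rep a n P) h n⟩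
  | parL Q t ih => exact ⟨(ih h.1).1, (ih h.1).2, h.2.shift _⟩
  | parR P t ih => exact ⟨(ih h.2).1, h.1.shift _, (ih h.2).2⟩
  | comL hP hQ ihP ihQ => exact ⟨by simp, NoInp.nuN.2 ⟨(ihP h.1).2, (ihQ h.2).2⟩⟩
  | comR hP hQ ihP ihQ => exact ⟨by simp, NoInp.nuN.2 ⟨(ihP h.1).2, (ihQ h.2).2⟩⟩
  | @res P P' μ t ih =>
    obtain ⟨h1, h2⟩ := ih (k := k + 1) h
    refine ⟨fun n e => h1 n (by subst e; rfl), ?_⟩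
    rw [Act.bn_rename] at h2
    refine NoInp.rename (k := k + 1 + μ.bn) (l := k + μ.bn + 1) h2 fun i e => ?_
    simp only [rot] at e
    grind
  | const t ih => exact ih (NoInp.body h)

/-! ## Structural laws, closed under contexts -/

/-- The least congruence containing the monoid laws of parallel composition, the laws of
restriction, garbage collection, unfolding of the constants, and the distribution laws for
restricted servers. It is a strong bisimulation. -/
inductive Cong : Proc → Proc → Prop where
  | refl (P : Proc) : Cong P P
  | symm {P Q : Proc} : Cong P Q → Cong Q P
  | trans {P Q R : Proc} : Cong P Q → Cong Q R → Cong P R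
  | parL {P Q : Proc} (R : Proc) : Cong P Q → Cong (.par P R) (.par Q R)
  | nu {P Q : Proc} : Cong P Q → Cong (.nu P) (.nu Q)
  | inp (a : Name) (n : ℕ) {P Q : Proc} : Cong P Q → Cong (.inp a n P) (.inp a n Q)
  | out (a : Name) (n : ℕ) {P Q : Proc} : Cong P Q → Cong (.out a n P) (.out a n Q)
  | rep (a : Name) (n : ℕ) {P Q : Proc} : Cong P Q → Cong (.rep a n P) (.rep a n Q)
  | rename {P Q : Proc} {f : Name → Name} (hf : f.Injective) :
      Cong P Q → Cong (P.rename f) (Q.rename f)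
  | par_comm (P Q : Proc) : Cong (.par P Q) (.par Q P)
  | par_assoc (P Q R : Proc) : Cong (.par (.par P Q) R) (.par P (.par Q R))
  | par_nil (P : Proc) : Cong (.par P .nil) P
  | nu_par (P Q : Proc) : Cong (.par (.nu P) Q) (.nu (.par P (Q.shift 1)))
  | nu_swap (P : Proc) : Cong (.nu (.nu P)) (.nu (.nu (P.rename (rot 1))))
  | nu_inert {Q : Proc} : Inert Q → Cong (.nu Q) .nil
  -- Below the prefix the restricted name has index `n`; `rot n` makes it the index `0` of the inner
  -- restriction.
  | push_out (a : Name) (n : ℕ) (P : Proc) {Q : Proc} : Inert Q →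
      Cong (.nu (.par (.out (a + 1) n P) Q)) (.out a n (.nu ((Proc.par P (Q.shift n)).rename (rot n))))
  | push_inp (a : Name) (n : ℕ) (P : Proc) {Q : Proc} : Inert Q →
      Cong (.nu (.par (.inp (a + 1) n P) Q)) (.inp a n (.nu ((Proc.par P (Q.shift n)).rename (rot n))))
  | push_rep (a : Name) (n : ℕ) {m : ℕ} {P B : Proc} : NoInp n P → NoInp m B →
      Cong (.nu (.par (.rep (a + 1) n P) (.rep 0 m B)))
        (.rep a n (.nu ((Proc.par P ((Proc.rep 0 m B).shift n)).rename (rot n))))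
  | push_out_self (n : ℕ) {m : ℕ} {P B : Proc} : NoInp n P → NoInp m B →
      Cong (.nu (.par (.out 0 n P) (.rep 0 m B)))
        (.nu (.par (.out 0 n ((Proc.nu ((Proc.par P ((Proc.rep 0 m B).shift n)).rename
          (rot n))).rename (liftN n Nat.succ))) (.rep 0 m B)))
  | link (k : Link) (a b : Name) : Cong (.link k a b) (k.body a b)
  | dist {P Q B : Proc} {m : ℕ} : NoInp 0 P → NoInp 0 Q → NoInp m B →
      Cong (.nu (.par (.par P Q) (.rep 0 m B)))
        (.par (.nu (.par P (.rep 0 m B))) (.nu (.par Q (.rep 0 m B))))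

namespace Cong

theorem of_eq {P Q : Proc} (h : P = Q) : Cong P Q := h ▸ refl P

theorem parR (P : Proc) {Q R : Proc} (h : Cong Q R) : Cong (.par P Q) (.par P R) :=
  (par_comm _ _).trans ((h.parL P).trans (par_comm _ _))

theorem par {P P' Q Q' : Proc} (h : Cong P P') (h' : Cong Q Q') : Cong (.par P Q) (.par P' Q') :=
  (h.parL Q).trans (h'.parR P')

theorem shift {P Q : Proc} (n : ℕ) (h : Cong P Q) : Cong (P.shift n) (Q.shift n) :=
  h.rename (add_injective n)

theorem nuN {P Q : Proc} (n : ℕ) (h : Cong P Q) : Cong (nuN n P) (nuN n Q) := by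
  induction n generalizing P Q with
  | zero => exact h
  | succ n ih => exact ih h.nu

theorem par_right_comm (P Q R : Proc) : Cong (.par (.par P Q) R) (.par (.par P R) Q) :=
  (par_assoc _ _ _).trans (((par_comm _ _).parR P).trans (par_assoc _ _ _).symm)

theorem par_left_comm (P Q R : Proc) : Cong (.par P (.par Q R)) (.par Q (.par P R)) :=
  (par_assoc _ _ _).symm.trans (((par_comm _ _).parL R).trans (par_assoc _ _ _))

theorem par_nu (P Q : Proc) : Cong (.par P (.nu Q)) (.nu (.par (P.shift 1) Q)) :=
  (par_comm _ _).trans ((nu_par _ _).trans (par_comm _ _).nu)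

theorem nuN_par (n : ℕ) (P Q : Proc) :
    Cong (.par (Proc.nuN n P) Q) (Proc.nuN n (.par P (Q.shift n))) := by
  induction n generalizing P Q with
  | zero => rw [shift_zero]; exact refl _
  | succ n ih =>
    refine (ih (.nu P) Q).trans (((nu_par _ _).trans (of_eq ?_)).nuN n)
    simp only [Proc.shift, rename_rename]
    rfl

theorem par_nuN (n : ℕ) (P Q : Proc) :
    Cong (.par P (Proc.nuN n Q)) (Proc.nuN n (.par (P.shift n) Q)) :=
  (par_comm _ _).trans ((nuN_par _ _ _).trans ((par_comm _ _).nuN n))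

theorem nu_nuN (n : ℕ) (P : Proc) :
    Cong (.nu (Proc.nuN n P)) (Proc.nuN n (.nu (P.rename (rot n)))) := by
  induction n generalizing P with
  | zero => rw [rename_rot_zero]; exact refl _
  | succ n ih =>
    refine (ih (.nu P)).trans (((nu_swap _).trans (of_eq ?_)).nuN n)
    rw [rename_rename, show rot 1 ∘ liftN 1 (rot n) = rot (n + 1) from ?_]
    funext i; simp only [rot, liftN, Function.comp]; grind

end Cong

/-! ## The structural laws form a strong bisimulation -/

/-- Every transition of `P` is matched by `Q`, up to the structural laws. -/
def Matches (P Q : Proc) : Prop :=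
  ∀ μ P', Trans P μ P' → ∃ Q', Trans Q μ Q' ∧ Cong P' Q'

namespace Matches

theorem parL {P Q : Proc} (R : Proc) (hc : Cong P Q) (h : Matches P Q) :
    Matches (.par P R) (.par Q R) := by
  intro μ X t
  replace t := t.par_inv
  obtain ⟨P', t, rfl⟩ | ⟨R', t, rfl⟩ | ⟨rfl, a, n, P', R', t, t', rfl⟩ |
    ⟨rfl, a, n, P', R', t, t', rfl⟩ := t
  · obtain ⟨Q', u, hu⟩ := h _ _ t
    exact ⟨_, .parL _ u, hu.parL _⟩
  · exact ⟨_, .parR _ t, (hc.shift _).parL _⟩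
  · obtain ⟨Q', u, hu⟩ := h _ _ t
    exact ⟨_, .comL u t', (hu.parL _).nuN n⟩
  · obtain ⟨Q', u, hu⟩ := h _ _ t
    exact ⟨_, .comR u t', (hu.parL _).nuN n⟩

theorem nu {P Q : Proc} (h : Matches P Q) : Matches (.nu P) (.nu Q) := by
  intro μ X t
  replace t := t.nu_inv
  obtain ⟨P', t, rfl⟩ := t
  obtain ⟨Q', u, hu⟩ := h _ _ t
  exact ⟨_, .res u, (hu.rename (rot_injective _)).nu⟩

theorem inp (a : Name) (n : ℕ) {P Q : Proc} (hc : Cong P Q) :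
    Matches (.inp a n P) (.inp a n Q) := by
  intro μ X t
  replace t := t.inp_inv
  obtain ⟨rfl, rfl⟩ := t
  exact ⟨_, .inp _ _ _, hc⟩

theorem out (a : Name) (n : ℕ) {P Q : Proc} (hc : Cong P Q) :
    Matches (.out a n P) (.out a n Q) := by
  intro μ X t
  replace t := t.out_inv
  obtain ⟨rfl, rfl⟩ := t
  exact ⟨_, .out _ _ _, hc⟩

theorem rep (a : Name) (n : ℕ) {P Q : Proc} (hc : Cong P Q) :
    Matches (.rep a n P) (.rep a n Q) := by
  intro μ X t
  replace t := t.rep_inv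
  obtain ⟨rfl, rfl⟩ := t
  exact ⟨_, .rep _ _ _, hc.par ((hc.rep a n).shift n)⟩

theorem rename {P Q : Proc} {f : Name → Name} (hf : f.Injective) (h : Matches P Q) :
    Matches (P.rename f) (Q.rename f) := by
  intro μ X t
  replace t := t.of_rename hf
  obtain ⟨μ, P', rfl, rfl, t⟩ := t
  obtain ⟨Q', u, hu⟩ := h _ _ t
  exact ⟨_, u.rename f, hu.rename (liftN_injective _ hf)⟩

theorem par_comm (P Q : Proc) : Matches (.par P Q) (.par Q P) := by
  intro μ X t
  replace t := t.par_inv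
  obtain ⟨P', t, rfl⟩ | ⟨R', t, rfl⟩ | ⟨rfl, a, n, P', R', t, t', rfl⟩ |
    ⟨rfl, a, n, P', R', t, t', rfl⟩ := t
  · exact ⟨_, .parR _ t, .par_comm _ _⟩
  · exact ⟨_, .parL _ t, .par_comm _ _⟩
  · exact ⟨_, .comR t' t, (Cong.par_comm _ _).nuN n⟩
  · exact ⟨_, .comL t' t, (Cong.par_comm _ _).nuN n⟩

theorem par_assoc (P Q R : Proc) : Matches (.par (.par P Q) R) (.par P (.par Q R)) := by
  intro μ X t
  replace t := t.par_inv
  obtain ⟨X, t, rfl⟩ | ⟨R', t, rfl⟩ | ⟨rfl, a, n, X, R', t, t', rfl⟩ |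
    ⟨rfl, a, n, X, R', t, t', rfl⟩ := t
  · replace t := t.par_inv
    obtain ⟨P', t, rfl⟩ | ⟨Q', t, rfl⟩ | ⟨rfl, a, n, P', Q', t, t', rfl⟩ |
      ⟨rfl, a, n, P', Q', t, t', rfl⟩ := t
    · exact ⟨_, .parL _ t, .par_assoc _ _ _⟩
    · exact ⟨_, .parR _ (.parL _ t), .par_assoc _ _ _⟩
    · refine ⟨_, .comL t (.parL _ t'), ?_⟩
      simp only [Act.bn, shift_zero]
      exact (Cong.nuN_par _ _ _).trans ((Cong.par_assoc _ _ _).nuN n)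
    · refine ⟨_, .comR t (.parL _ t'), ?_⟩
      simp only [Act.bn, shift_zero]
      exact (Cong.nuN_par _ _ _).trans ((Cong.par_assoc _ _ _).nuN n)
  · exact ⟨_, .parR _ (.parR _ t), .par_assoc _ _ _⟩
  · replace t := t.par_inv
    obtain ⟨P', t, rfl⟩ | ⟨Q', t, rfl⟩ | ⟨h, _⟩ | ⟨h, _⟩ := t
    · exact ⟨_, .comL t (.parR _ t'), (Cong.par_assoc _ _ _).nuN n⟩
    · refine ⟨_, .parR _ (.comL t t'), ?_⟩
      simp only [Act.bn, shift_zero]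
      exact ((Cong.par_assoc _ _ _).nuN n).trans (Cong.par_nuN _ _ _).symm
    · simp at h
    · simp at h
  · replace t := t.par_inv
    obtain ⟨P', t, rfl⟩ | ⟨Q', t, rfl⟩ | ⟨h, _⟩ | ⟨h, _⟩ := t
    · exact ⟨_, .comR t (.parR _ t'), (Cong.par_assoc _ _ _).nuN n⟩
    · refine ⟨_, .parR _ (.comR t t'), ?_⟩
      simp only [Act.bn, shift_zero]
      exact ((Cong.par_assoc _ _ _).nuN n).trans (Cong.par_nuN _ _ _).symm
    · simp at h
    · simp at h

theorem trans {P Q R : Proc} (h : Matches P Q) (h' : Matches Q R) : Matches P R := by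
  intro μ X t
  obtain ⟨Q', u, hu⟩ := h _ _ t
  obtain ⟨R', v, hv⟩ := h' _ _ u
  exact ⟨R', v, hu.trans hv⟩

/-- Commutativity reduces this direction to the other one, sparing a second case analysis. -/
theorem par_assoc_symm (P Q R : Proc) : Matches (.par P (.par Q R)) (.par (.par P Q) R) :=
  (par_comm _ _).trans <| (par_assoc _ _ _).trans <| (par_comm _ _).trans <|
    (par_assoc _ _ _).trans (par_comm _ _)

theorem par_nil (P : Proc) : Matches (.par P .nil) P := by
  intro μ X t
  replace t := t.par_inv
  obtain ⟨P', t, rfl⟩ | ⟨R', t, rfl⟩ | ⟨rfl, a, n, P', R', t, t', rfl⟩ |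
    ⟨rfl, a, n, P', R', t, t', rfl⟩ := t
  · exact ⟨_, t, .par_nil _⟩
  · exact t.nil_inv.elim
  · exact t'.nil_inv.elim
  · exact t'.nil_inv.elim

theorem par_nil_symm (P : Proc) : Matches P (.par P .nil) :=
  fun _ _ t => ⟨_, .parL _ t, (Cong.par_nil _).symm⟩

theorem rename_liftN_succ_rot (P : Proc) (n : ℕ) :
    (P.rename (liftN n Nat.succ)).rename (rot n) = P.shift 1 := by
  rw [rename_rename, rot_comp_liftN_succ]; rfl

theorem shift_shift_rot (P : Proc) (n : ℕ) :
    ((P.shift 1).shift n).rename (rot n) = (P.shift n).shift 1 := by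
  rw [shift_rename_rot, shift_rename_liftN]; rfl

theorem nu_par (P Q : Proc) : Matches (.par (.nu P) Q) (.nu (.par P (Q.shift 1))) := by
  intro μ X t
  replace t := t.par_inv
  obtain ⟨X, t, rfl⟩ | ⟨Q', t, rfl⟩ | ⟨rfl, a, n, X, Q', t, t', rfl⟩ |
    ⟨rfl, a, n, X, Q', t, t', rfl⟩ := t
  · replace t := t.nu_inv
    obtain ⟨P', t, rfl⟩ := t
    refine ⟨_, .res (.parL _ t), (Cong.nu_par _ _).trans (.of_eq ?_)⟩
    simp [Proc.rename, shift_shift_rot]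
  · refine ⟨_, .res (.parR _ (t.rename Nat.succ)), (Cong.nu_par _ _).trans (.of_eq ?_)⟩
    simp only [Proc.rename, Act.bn_rename, shift_rename_rot, rename_liftN_succ_rot]
  · replace t := t.nu_inv
    obtain ⟨P', t, rfl⟩ := t
    refine ⟨_, .res_tau (.comL t (t'.rename Nat.succ)), Cong.trans ?_ (Cong.nu_nuN _ _).symm⟩
    refine Cong.nuN n ((Cong.nu_par _ _).trans (.of_eq ?_))
    simp [Proc.rename, rename_liftN_succ_rot, Act.bn]
  · replace t := t.nu_inv
    obtain ⟨P', t, rfl⟩ := t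
    refine ⟨_, .res_tau (.comR t (t'.rename Nat.succ)), Cong.trans ?_ (Cong.nu_nuN _ _).symm⟩
    refine Cong.nuN n ((Cong.nu_par _ _).trans (.of_eq ?_))
    simp [Proc.rename, rename_liftN_succ_rot, Act.bn]

theorem nu_par_symm (P Q : Proc) : Matches (.nu (.par P (Q.shift 1))) (.par (.nu P) Q) := by
  intro μ X t
  replace t := t.nu_inv
  obtain ⟨X, t, rfl⟩ := t
  replace t := t.par_inv
  obtain ⟨P', t, rfl⟩ | ⟨Q', t, rfl⟩ | ⟨h, a, n, P', Q', t, t', rfl⟩ |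
    ⟨h, a, n, P', Q', t, t', rfl⟩ := t
  · refine ⟨_, .parL _ (.res t), Cong.symm ((Cong.nu_par _ _).trans (.of_eq ?_))⟩
    simp [Proc.rename, shift_shift_rot]
  · replace t := t.of_rename (add_injective 1)
    obtain ⟨ν, Q', e, rfl, t⟩ := t
    cases Act.rename_injective (add_injective 1) e
    refine ⟨_, .parR _ t, Cong.symm ((Cong.nu_par _ _).trans (.of_eq ?_))⟩
    have := rename_liftN_succ_rot Q' μ.bn
    simp only [Proc.rename, Act.bn_rename, shift_rename_rot]
    rw [← this]
  · rw [Act.rename_eq_tau] at h; subst h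
    replace t' := t'.of_rename (add_injective 1)
    obtain ⟨ν, Q', e, rfl, t'⟩ := t'
    cases ν <;> simp [Act.rename] at e
    obtain ⟨rfl, rfl⟩ := e
    refine ⟨_, .comL (.res (μ := .out _ _) t) t', ?_⟩
    rw [Act.bn, rename_rot_zero]
    refine (Cong.nu_nuN _ _).trans (Cong.nuN n (Cong.symm ((Cong.nu_par _ _).trans (.of_eq ?_))))
    have := rename_liftN_succ_rot Q' n
    simp_all [Proc.rename, Act.bn]
  · rw [Act.rename_eq_tau] at h; subst h
    replace t' := t'.of_rename (add_injective 1)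
    obtain ⟨ν, Q', e, rfl, t'⟩ := t'
    cases ν <;> simp [Act.rename] at e
    obtain ⟨rfl, rfl⟩ := e
    refine ⟨_, .comR (.res (μ := .inp _ _) t) t', ?_⟩
    rw [Act.bn, rename_rot_zero]
    refine (Cong.nu_nuN _ _).trans (Cong.nuN n (Cong.symm ((Cong.nu_par _ _).trans (.of_eq ?_))))
    have := rename_liftN_succ_rot Q' n
    simp_all [Proc.rename, Act.bn]

theorem rot_one_rot_one (i : Name) : (rot 1 ∘ rot 1) i = i := by
  obtain _ | _ | i := i <;> simp [rot]

theorem rot_one_comp_rot (n : ℕ) :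
    rot 1 ∘ liftN 1 (rot n) ∘ rot n = liftN 1 (rot n) ∘ rot n ∘ liftN n (rot 1) := by
  funext i
  obtain h | ⟨j, rfl⟩ : i < n ∨ ∃ j, i = j + n := by
    by_cases h : i < n
    · exact .inl h
    · exact .inr ⟨i - n, by grind⟩
  · have : i + 1 ≠ n + 1 := by grind
    simp [rot, liftN, h]
  · obtain _ | _ | j := j
    · simp [rot, liftN]
    · simp [rot, liftN]
    · simp [rot, liftN, show ¬ j + 1 + 1 + n < n by grind]

theorem nu_swap (P : Proc) : Matches (.nu (.nu P)) (.nu (.nu (P.rename (rot 1)))) := by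
  intro μ X t
  replace t := t.nu_inv
  obtain ⟨X, t, rfl⟩ := t
  replace t := t.nu_inv
  obtain ⟨P', t, rfl⟩ := t
  have u := t.rename (rot 1)
  have e : ((μ.rename Nat.succ).rename Nat.succ).rename (rot 1) =
      (μ.rename Nat.succ).rename Nat.succ := by
    cases μ <;> simp [Act.rename, rot]
  rw [e] at u
  refine ⟨_, u.res.res, (Cong.nu_swap _).trans (.of_eq ?_)⟩
  simp only [Proc.rename, Act.bn_rename, rename_rename]
  congr 3
  exact rot_one_comp_rot _

theorem nu_swap_symm (P : Proc) : Matches (.nu (.nu (P.rename (rot 1)))) (.nu (.nu P)) := by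
  have := nu_swap (P.rename (rot 1))
  rwa [rename_rename, rename_eq_self P rot_one_rot_one] at this

theorem rename_succ_ne_inp_zero (μ : Act) (m : ℕ) : μ.rename Nat.succ ≠ .inp 0 m := by
  cases μ <;> simp [Act.rename]

theorem nu_inert {Q : Proc} (h : Inert Q) : Matches (.nu Q) .nil := by
  intro μ X t
  replace t := t.nu_inv
  obtain ⟨Q', t, -⟩ := t
  obtain ⟨m, e⟩ := h _ _ t
  exact (rename_succ_ne_inp_zero _ _ e).elim

theorem nil (Q : Proc) : Matches .nil Q := fun _ _ t => t.nil_inv.elim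

/-- All that `Q` can do is input at the restricted name, which is not the subject of the prefix; so
the output is the only transition on either side. -/
theorem push_out (a : Name) (n : ℕ) (P : Proc) {Q : Proc} (hQ : Inert Q) :
    Matches (.nu (.par (.out (a + 1) n P) Q))
      (.out a n (.nu ((Proc.par P (Q.shift n)).rename (rot n)))) := by
  intro μ X t
  replace t := t.nu_inv
  obtain ⟨X, t, rfl⟩ := t
  replace t := t.par_inv
  obtain ⟨P', t, rfl⟩ | ⟨Q', t, rfl⟩ | ⟨h, b, m, P', Q', t, t', rfl⟩ |
    ⟨h, b, m, P', Q', t, t', rfl⟩ := t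
  · replace t := t.out_inv
    obtain ⟨e, rfl⟩ := t
    cases μ <;> simp [Act.rename] at e
    obtain ⟨rfl, rfl⟩ := e
    exact ⟨_, .out _ _ _, .refl _⟩
  · obtain ⟨m, e⟩ := hQ _ _ t
    exact (rename_succ_ne_inp_zero _ _ e).elim
  · replace t := t.out_inv
    obtain ⟨e, rfl⟩ := t
    obtain ⟨m, e'⟩ := hQ _ _ t'
    simp_all
  · replace t := t.out_inv
    obtain ⟨e, rfl⟩ := t
    simp at e

theorem push_out_symm (a : Name) (n : ℕ) (P Q : Proc) :
    Matches (.out a n (.nu ((Proc.par P (Q.shift n)).rename (rot n))))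
      (.nu (.par (.out (a + 1) n P) Q)) := by
  intro μ X t
  replace t := t.out_inv
  obtain ⟨rfl, rfl⟩ := t
  exact ⟨_, .res (μ := .out a n) (.parL _ (.out _ _ _)), .refl _⟩

theorem push_inp (a : Name) (n : ℕ) (P : Proc) {Q : Proc} (hQ : Inert Q) :
    Matches (.nu (.par (.inp (a + 1) n P) Q))
      (.inp a n (.nu ((Proc.par P (Q.shift n)).rename (rot n)))) := by
  intro μ X t
  replace t := t.nu_inv
  obtain ⟨X, t, rfl⟩ := t
  replace t := t.par_inv
  obtain ⟨P', t, rfl⟩ | ⟨Q', t, rfl⟩ | ⟨h, b, m, P', Q', t, t', rfl⟩ |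
    ⟨h, b, m, P', Q', t, t', rfl⟩ := t
  · replace t := t.inp_inv
    obtain ⟨e, rfl⟩ := t
    cases μ <;> simp [Act.rename] at e
    obtain ⟨rfl, rfl⟩ := e
    exact ⟨_, .inp _ _ _, .refl _⟩
  · obtain ⟨m, e⟩ := hQ _ _ t
    exact (rename_succ_ne_inp_zero _ _ e).elim
  · replace t := t.inp_inv
    obtain ⟨e, rfl⟩ := t
    simp at e
  · obtain ⟨m, e'⟩ := hQ _ _ t'
    simp at e'

theorem push_inp_symm (a : Name) (n : ℕ) (P Q : Proc) :
    Matches (.inp a n (.nu ((Proc.par P (Q.shift n)).rename (rot n))))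
      (.nu (.par (.inp (a + 1) n P) Q)) := by
  intro μ X t
  replace t := t.inp_inv
  obtain ⟨rfl, rfl⟩ := t
  exact ⟨_, .res (μ := .inp a n) (.parL _ (.inp _ _ _)), .refl _⟩

theorem link (k : Link) (a b : Name) : Matches (.link k a b) (k.body a b) :=
  fun _ _ t => ⟨_, t.link_inv, .refl _⟩

theorem link_symm (k : Link) (a b : Name) : Matches (k.body a b) (.link k a b) :=
  fun _ _ t => ⟨_, .const t, .refl _⟩

end Matches

/-! ### Distribution of restricted servers -/

/-- Moving a server past `n` further bound names. -/
theorem server_rename_rot (n m : ℕ) (B : Proc) :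
    ((Proc.rep 0 m B).shift n).rename (rot n) =
      .rep 0 m (B.rename (liftN m (liftN 1 (· + n)))) := by
  rw [shift_rename_rot]
  simp [Proc.rename, liftN]

theorem NoInp.server_body {m : ℕ} {B : Proc} (h : NoInp m B) (n : ℕ) :
    NoInp m (B.rename (liftN m (liftN 1 (· + n)))) := by
  refine h.rename fun i e => ?_
  simp only [liftN] at e
  grind

/-- The subject of the server is restricted, so the server moves only when `P` calls it. -/
theorem Trans.server_inv {P B X : Proc} {m : ℕ} {μ : Act}
    (t : Trans (.nu (.par P (.rep 0 m B))) μ X) :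
    (∃ P', Trans P (μ.rename Nat.succ) P' ∧
      X = .nu (.par (P'.rename (rot μ.bn)) (((Proc.rep 0 m B).shift μ.bn).rename (rot μ.bn)))) ∨
    (μ = .tau ∧ ∃ P', Trans P (.out 0 m) P' ∧
      X = .nu (nuN m (.par P' (.par B ((Proc.rep 0 m B).shift m))))) := by
  replace t := t.nu_inv
  obtain ⟨X, t, rfl⟩ := t
  replace t := t.par_inv
  obtain ⟨P', t, rfl⟩ | ⟨Q', t, rfl⟩ | ⟨h, b, k, P', Q', t, t', rfl⟩ |
    ⟨h, b, k, P', Q', t, t', rfl⟩ := t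
  · exact .inl ⟨P', t, by simp [Proc.rename]⟩
  · exact (Matches.rename_succ_ne_inp_zero _ _ t.rep_inv.1).elim
  · replace t' := t'.rep_inv
    obtain ⟨e, rfl⟩ := t'
    cases e
    rw [Act.rename_eq_tau] at h; subst h
    exact .inr ⟨rfl, P', t, by rw [Act.bn, rename_rot_zero]⟩
  · replace t' := t'.rep_inv
    obtain ⟨e, -⟩ := t'
    simp at e

theorem Trans.server_act {P P' : Proc} {μ : Act} (m : ℕ) (B : Proc)
    (t : Trans P (μ.rename Nat.succ) P') :
    Trans (.nu (.par P (.rep 0 m B))) μ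
      (.nu (.par (P'.rename (rot μ.bn)) (((Proc.rep 0 m B).shift μ.bn).rename (rot μ.bn)))) := by
  have := Trans.res (t.parL (.rep 0 m B))
  simpa [Proc.rename] using this

theorem Trans.server_call {P P' : Proc} {m : ℕ} (B : Proc) (t : Trans P (.out 0 m) P') :
    Trans (.nu (.par P (.rep 0 m B))) .tau
      (.nu (nuN m (.par P' (.par B ((Proc.rep 0 m B).shift m))))) :=
  .res_tau (.comL t (.rep _ _ _))

namespace Cong

theorem server_call (P B : Proc) (m : ℕ) :
    Cong (.nu (Proc.nuN m (.par P (.par B ((Proc.rep 0 m B).shift m)))))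
      (.nu (.par (Proc.nuN m (.par P B)) (.rep 0 m B))) :=
  nu (((par_assoc _ _ _).symm.nuN m).trans (nuN_par _ _ _).symm)

theorem dist_rename_rot {P Q B : Proc} {m : ℕ} (n : ℕ) (hP : NoInp n P) (hQ : NoInp n Q)
    (hB : NoInp m B) :
    Cong (.nu (.par (.par (P.rename (rot n)) (Q.rename (rot n)))
        (((Proc.rep 0 m B).shift n).rename (rot n))))
      (.par (.nu (.par (P.rename (rot n)) (((Proc.rep 0 m B).shift n).rename (rot n))))
        (.nu (.par (Q.rename (rot n)) (((Proc.rep 0 m B).shift n).rename (rot n))))) := by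
  rw [server_rename_rot]
  exact dist hP.rename_rot hQ.rename_rot (hB.server_body n)

theorem server_shift (Q B : Proc) (m n : ℕ) :
    (Proc.nu (.par Q (.rep 0 m B))).shift n =
      .nu (.par ((Q.shift n).rename (rot n)) (((Proc.rep 0 m B).shift n).rename (rot n))) := by
  simp only [Proc.shift, Proc.rename, rename_rename, ← rot_comp_add, liftN_comp]
  rfl

end Cong

namespace Matches

theorem dist_comm {P' Q' B : Proc} {m n : ℕ} (hP : NoInp n P') (hQ : NoInp n Q')
    (hB : NoInp m B) :
    Cong (.nu (.par (Proc.nuN n (.par P' Q')) (.rep 0 m B)))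
      (Proc.nuN n (.par
        (.nu (.par (P'.rename (rot n)) (((Proc.rep 0 m B).shift n).rename (rot n))))
        (.nu (.par (Q'.rename (rot n)) (((Proc.rep 0 m B).shift n).rename (rot n)))))) := by
  refine ((Cong.nuN_par _ _ _).nu.trans (Cong.nu_nuN _ _)).trans (Cong.nuN n ?_)
  exact Cong.dist_rename_rot n hP hQ hB

theorem dist_call {P' Q B : Proc} {m : ℕ} (hP' : NoInp m P') (hQ : NoInp 0 Q)
    (hB : NoInp m B) :
    Cong (.nu (Proc.nuN m (.par (.par P' (Q.shift m)) (.par B ((Proc.rep 0 m B).shift m)))))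
      (.par (.nu (Proc.nuN m (.par P' (.par B ((Proc.rep 0 m B).shift m)))))
        (.nu (.par Q (.rep 0 m B)))) := by
  refine (Cong.server_call _ _ _).trans ?_
  refine Cong.trans ?_ ((Cong.server_call _ _ _).symm.parL _)
  refine Cong.trans ?_ (Cong.dist (NoInp.nuN.2 ⟨by simpa using hP', by simpa using hB⟩) hQ hB)
  exact (((Cong.par_right_comm _ _ _).nuN m).trans (Cong.nuN_par _ _ _).symm).parL _ |>.nu

/-- Neither `P` nor `Q` inputs at the name of the server, so they cannot synchronise there with each
other; every use of that name is a call by one side, which its own copy can serve. `NoInp` survives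
transitions, also after a copy of the body `B` has been spawned. -/
theorem dist {P Q B : Proc} {m : ℕ} (hP : NoInp 0 P) (hQ : NoInp 0 Q) (hB : NoInp m B) :
    Matches (.nu (.par (.par P Q) (.rep 0 m B)))
      (.par (.nu (.par P (.rep 0 m B))) (.nu (.par Q (.rep 0 m B)))) := by
  intro μ X t
  replace t := t.server_inv
  obtain ⟨X, t, rfl⟩ | ⟨rfl, X, t, rfl⟩ := t
  · replace t := t.par_inv
    obtain ⟨P', t, rfl⟩ | ⟨Q', t, rfl⟩ | ⟨h, b, n, P', Q', t, t', rfl⟩ |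
      ⟨h, b, n, P', Q', t, t', rfl⟩ := t
    · refine ⟨_, .parL _ (t.server_act m B), ?_⟩
      rw [Cong.server_shift, Act.bn_rename]
      have := (hP.trans t).2
      rw [Act.bn_rename, Nat.zero_add] at this
      exact Cong.dist_rename_rot _ this (by simpa using hQ.shift μ.bn) hB
    · refine ⟨_, .parR _ (t.server_act m B), ?_⟩
      rw [Cong.server_shift, Act.bn_rename]
      have := (hQ.trans t).2
      rw [Act.bn_rename, Nat.zero_add] at this
      exact Cong.dist_rename_rot _ (by simpa using hP.shift μ.bn) this hB
    · rw [Act.rename_eq_tau] at h; subst h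
      obtain ⟨h1, h2⟩ := hQ.trans t'
      obtain ⟨-, h3⟩ := hP.trans t
      obtain _ | b := b
      · exact (h1 n rfl).elim
      refine ⟨_, .comL (Trans.server_act (μ := .out b n) m B t)
        (Trans.server_act (μ := .inp b n) m B t'), ?_⟩
      simp only [Act.bn, Nat.zero_add, rename_rot_zero, shift_zero] at h2 h3 ⊢
      exact dist_comm h3 h2 hB
    · rw [Act.rename_eq_tau] at h; subst h
      obtain ⟨h1, h2⟩ := hP.trans t
      obtain ⟨-, h3⟩ := hQ.trans t'
      obtain _ | b := b
      · exact (h1 n rfl).elim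
      refine ⟨_, .comR (Trans.server_act (μ := .inp b n) m B t)
        (Trans.server_act (μ := .out b n) m B t'), ?_⟩
      simp only [Act.bn, Nat.zero_add, rename_rot_zero, shift_zero] at h2 h3 ⊢
      exact dist_comm h2 h3 hB
  · replace t := t.par_inv
    obtain ⟨P', t, rfl⟩ | ⟨Q', t, rfl⟩ | ⟨h, _⟩ | ⟨h, _⟩ := t
    · refine ⟨_, .parL _ (t.server_call B), ?_⟩
      rw [Act.bn, shift_zero]
      exact dist_call (by simpa [Act.bn] using (hP.trans t).2) hQ hB
    · refine ⟨_, .parR _ (t.server_call B), ?_⟩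
      rw [Act.bn, shift_zero]
      refine Cong.trans ?_ (Cong.par_comm _ _)
      refine Cong.trans ?_ (dist_call (by simpa [Act.bn] using (hQ.trans t).2) hP hB)
      exact (((Cong.par_comm _ _).parL _).nuN m).nu
    · simp at h
    · simp at h

theorem dist_symm {P Q B : Proc} {m : ℕ} (hP : NoInp 0 P) (hQ : NoInp 0 Q) (hB : NoInp m B) :
    Matches (.par (.nu (.par P (.rep 0 m B))) (.nu (.par Q (.rep 0 m B))))
      (.nu (.par (.par P Q) (.rep 0 m B))) := by
  intro μ X t
  replace t := t.par_inv
  obtain ⟨X, t, rfl⟩ | ⟨X, t, rfl⟩ | ⟨rfl, b, n, X, Y, t, t', rfl⟩ |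
    ⟨rfl, b, n, X, Y, t, t', rfl⟩ := t
  · replace t := t.server_inv
    obtain ⟨P', t, rfl⟩ | ⟨rfl, P', t, rfl⟩ := t
    · refine ⟨_, (t.parL Q).server_act m B, ?_⟩
      rw [Cong.server_shift, Act.bn_rename]
      have := (hP.trans t).2
      rw [Act.bn_rename, Nat.zero_add] at this
      exact (Cong.dist_rename_rot _ this (by simpa using hQ.shift μ.bn) hB).symm
    · refine ⟨_, (t.parL Q).server_call B, ?_⟩
      rw [Act.bn, shift_zero]
      exact (dist_call (by simpa [Act.bn] using (hP.trans t).2) hQ hB).symm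
  · replace t := t.server_inv
    obtain ⟨Q', t, rfl⟩ | ⟨rfl, Q', t, rfl⟩ := t
    · refine ⟨_, (t.parR P).server_act m B, ?_⟩
      rw [Cong.server_shift, Act.bn_rename]
      have := (hQ.trans t).2
      rw [Act.bn_rename, Nat.zero_add] at this
      exact (Cong.dist_rename_rot _ (by simpa using hP.shift μ.bn) this hB).symm
    · refine ⟨_, (t.parR P).server_call B, Cong.symm ?_⟩
      rw [Act.bn, shift_zero]
      refine Cong.trans ?_ (Cong.par_comm _ _)
      refine Cong.trans ?_ (dist_call (by simpa [Act.bn] using (hQ.trans t).2) hP hB)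
      exact (((Cong.par_comm _ _).parL _).nuN m).nu
  · replace t := t.server_inv
    obtain ⟨P', t, rfl⟩ | ⟨h, _⟩ := t
    · replace t' := t'.server_inv
      obtain ⟨Q', t', rfl⟩ | ⟨h, _⟩ := t'
      · refine ⟨_, Trans.server_act (μ := .tau) m B (.comL t t'), ?_⟩
        have h2 := (hP.trans t).2
        have h3 := (hQ.trans t').2
        simp only [Act.bn, Act.rename, Nat.zero_add, rename_rot_zero, shift_zero] at h2 h3 ⊢
        exact (dist_comm h2 h3 hB).symm
      · simp at h
    · simp at h
  · replace t := t.server_inv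
    obtain ⟨P', t, rfl⟩ | ⟨h, _⟩ := t
    · replace t' := t'.server_inv
      obtain ⟨Q', t', rfl⟩ | ⟨h, _⟩ := t'
      · refine ⟨_, Trans.server_act (μ := .tau) m B (.comR t t'), ?_⟩
        have h2 := (hP.trans t).2
        have h3 := (hQ.trans t').2
        simp only [Act.bn, Act.rename, Nat.zero_add, rename_rot_zero, shift_zero] at h2 h3 ⊢
        exact (dist_comm h2 h3 hB).symm
      · simp at h
    · simp at h

/-- After an input the server is shared by one instance of `P` and the remaining replication: `dist`
gives each a copy, and the law `Cong.push_rep` applies again to the replication. -/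
theorem push_rep_cong (a : Name) (n : ℕ) {m : ℕ} {P B : Proc} (hP : NoInp n P)
    (hB : NoInp m B) :
    Cong (.nu (.par ((Proc.par P ((Proc.rep (a + 1) n P).shift n)).rename (rot n))
        (((Proc.rep 0 m B).shift n).rename (rot n))))
      (.par (.nu ((Proc.par P ((Proc.rep 0 m B).shift n)).rename (rot n)))
        ((Proc.rep a n (.nu ((Proc.par P ((Proc.rep 0 m B).shift n)).rename (rot n)))).shift n)) := by
  have h0 : NoInp 0 (Proc.rep (a + 1) n P) := ⟨Nat.succ_ne_zero a, by simpa using hP⟩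
  refine (Cong.dist_rename_rot n hP (by simpa using h0.shift n) hB).trans (Cong.parR _ ?_)
  rw [← Cong.server_shift]
  exact (Cong.push_rep a n hP hB).shift n

theorem push_rep (a : Name) (n : ℕ) {m : ℕ} {P B : Proc} (hP : NoInp n P) (hB : NoInp m B) :
    Matches (.nu (.par (.rep (a + 1) n P) (.rep 0 m B)))
      (.rep a n (.nu ((Proc.par P ((Proc.rep 0 m B).shift n)).rename (rot n)))) := by
  intro μ X t
  replace t := t.server_inv
  obtain ⟨P', t, rfl⟩ | ⟨rfl, P', t, rfl⟩ := t
  · replace t := t.rep_inv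
    obtain ⟨e, rfl⟩ := t
    cases μ <;> simp [Act.rename] at e
    obtain ⟨rfl, rfl⟩ := e
    exact ⟨_, .rep _ _ _, push_rep_cong _ _ hP hB⟩
  · simpa using t.rep_inv.1

theorem push_rep_symm (a : Name) (n : ℕ) {m : ℕ} {P B : Proc} (hP : NoInp n P)
    (hB : NoInp m B) :
    Matches (.rep a n (.nu ((Proc.par P ((Proc.rep 0 m B).shift n)).rename (rot n))))
      (.nu (.par (.rep (a + 1) n P) (.rep 0 m B))) := by
  intro μ X t
  replace t := t.rep_inv
  obtain ⟨rfl, rfl⟩ := t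
  exact ⟨_, Trans.server_act (μ := .inp a n) m B (.rep _ _ _), (push_rep_cong _ _ hP hB).symm⟩

/-- After the call, `dist` separates the continuation `P` of the message from the spawned body `B`.
The copy given to `P` is the private one; the other stays with `B`. -/
theorem push_out_self_cong {m : ℕ} {P B : Proc} (hP : NoInp m P) (hB : NoInp m B) :
    Cong (.nu (Proc.nuN m (.par P (.par B ((Proc.rep 0 m B).shift m)))))
      (.nu (Proc.nuN m (.par ((Proc.nu ((Proc.par P ((Proc.rep 0 m B).shift m)).rename
        (rot m))).rename (liftN m Nat.succ)) (.par B ((Proc.rep 0 m B).shift m))))) := by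
  refine (Cong.nu_nuN _ _).trans (Cong.trans (Cong.nuN m ?_) (Cong.nu_nuN _ _).symm)
  refine (Cong.par_assoc _ _ _).symm.nu.trans ((Cong.dist_rename_rot m hP hB hB).trans ?_)
  refine (Cong.par_nu _ _).trans (.of_eq ?_)
  rw [Proc.rename, rename_liftN_succ_rot]
  rfl

theorem push_out_self (n : ℕ) {m : ℕ} {P B : Proc} (hP : NoInp n P) (hB : NoInp m B) :
    Matches (.nu (.par (.out 0 n P) (.rep 0 m B)))
      (.nu (.par (.out 0 n ((Proc.nu ((Proc.par P ((Proc.rep 0 m B).shift n)).rename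
          (rot n))).rename (liftN n Nat.succ))) (.rep 0 m B))) := by
  intro μ X t
  replace t := t.server_inv
  obtain ⟨P', t, rfl⟩ | ⟨rfl, P', t, rfl⟩ := t
  · replace t := t.out_inv
    obtain ⟨e, rfl⟩ := t
    cases μ <;> simp [Act.rename] at e
  · replace t := t.out_inv
    obtain ⟨e, rfl⟩ := t
    cases e
    exact ⟨_, .server_call B (.out _ _ _), push_out_self_cong hP hB⟩

theorem push_out_self_symm (n : ℕ) {m : ℕ} {P B : Proc} (hP : NoInp n P) (hB : NoInp m B) :
    Matches (.nu (.par (.out 0 n ((Proc.nu ((Proc.par P ((Proc.rep 0 m B).shift n)).rename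
          (rot n))).rename (liftN n Nat.succ))) (.rep 0 m B)))
      (.nu (.par (.out 0 n P) (.rep 0 m B))) := by
  intro μ X t
  replace t := t.server_inv
  obtain ⟨P', t, rfl⟩ | ⟨rfl, P', t, rfl⟩ := t
  · replace t := t.out_inv
    obtain ⟨e, rfl⟩ := t
    cases μ <;> simp [Act.rename] at e
  · replace t := t.out_inv
    obtain ⟨e, rfl⟩ := t
    cases e
    exact ⟨_, .server_call B (.out _ _ _), (push_out_self_cong hP hB).symm⟩

theorem refl (P : Proc) : Matches P P := fun _ _ t => ⟨_, t, .refl _⟩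

end Matches

/-- Both directions are proved together because of the constructor `symm`. -/
theorem Cong.matches_both {P Q : Proc} (h : Cong P Q) : Matches P Q ∧ Matches Q P := by
  induction h with
  | refl P => exact ⟨.refl P, .refl P⟩
  | symm _ ih => exact ih.symm
  | trans _ _ ih ih' => exact ⟨ih.1.trans ih'.1, ih'.2.trans ih.2⟩
  | parL R h ih => exact ⟨.parL R h ih.1, .parL R h.symm ih.2⟩
  | nu _ ih => exact ⟨ih.1.nu, ih.2.nu⟩
  | inp a n h _ => exact ⟨.inp a n h, .inp a n h.symm⟩
  | out a n h _ => exact ⟨.out a n h, .out a n h.symm⟩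
  | rep a n h _ => exact ⟨.rep a n h, .rep a n h.symm⟩
  | rename hf _ ih => exact ⟨ih.1.rename hf, ih.2.rename hf⟩
  | par_comm P Q => exact ⟨.par_comm P Q, .par_comm Q P⟩
  | par_assoc P Q R => exact ⟨.par_assoc P Q R, .par_assoc_symm P Q R⟩
  | par_nil P => exact ⟨.par_nil P, .par_nil_symm P⟩
  | nu_par P Q => exact ⟨.nu_par P Q, .nu_par_symm P Q⟩
  | nu_swap P => exact ⟨.nu_swap P, .nu_swap_symm P⟩
  | nu_inert h => exact ⟨.nu_inert h, .nil _⟩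
  | push_out a n P h => exact ⟨.push_out a n P h, .push_out_symm a n P _⟩
  | push_inp a n P h => exact ⟨.push_inp a n P h, .push_inp_symm a n P _⟩
  | push_rep a n hP hB => exact ⟨.push_rep a n hP hB, .push_rep_symm a n hP hB⟩
  | push_out_self n hP hB => exact ⟨.push_out_self n hP hB, .push_out_self_symm n hP hB⟩
  | link k a b => exact ⟨.link k a b, .link_symm k a b⟩
  | dist hP hQ hB => exact ⟨.dist hP hQ hB, .dist_symm hP hQ hB⟩

theorem Cong.matches {P Q : Proc} (h : Cong P Q) : Matches P Q := h.matches_both.1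

end CbvPiI

/-! ### Up-to techniques; expansion is a precongruence. -/

namespace CbvPiI

open Proc

/-! ## Weak transitions in contexts -/

namespace TauStar

theorem refl (P : Proc) : TauStar P P := Relation.ReflTransGen.refl

theorem single {P P' : Proc} (t : Trans P .tau P') : TauStar P P' := Relation.ReflTransGen.single t

theorem trans {P Q R : Proc} (h : TauStar P Q) (h' : TauStar Q R) : TauStar P R :=
  Relation.ReflTransGen.trans h h'

theorem map (F : Proc → Proc) (hF : ∀ P P', Trans P .tau P' → Trans (F P) .tau (F P'))
    {P P' : Proc} (h : TauStar P P') : TauStar (F P) (F P') := by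
  induction h with
  | refl => exact refl _
  | tail _ t ih => exact ih.trans (single (hF _ _ t))

theorem parL {P P' : Proc} (Q : Proc) (h : TauStar P P') : TauStar (.par P Q) (.par P' Q) := by
  refine h.map (fun P => Proc.par P Q) (fun _ _ t => ?_)
  have := t.parL Q
  rwa [Act.bn, shift_zero] at this

theorem parR {Q Q' : Proc} (P : Proc) (h : TauStar Q Q') : TauStar (.par P Q) (.par P Q') := by
  refine h.map (fun Q => Proc.par P Q) (fun _ _ t => ?_)
  have := t.parR P
  rwa [Act.bn, shift_zero] at this

theorem par {P P' Q Q' : Proc} (h : TauStar P P') (h' : TauStar Q Q') :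
    TauStar (.par P Q) (.par P' Q') :=
  (h.parL Q).trans (h'.parR P')

theorem nu {P P' : Proc} (h : TauStar P P') : TauStar (.nu P) (.nu P') :=
  h.map _ (fun _ _ t => t.res_tau)

theorem nuN (n : ℕ) {P P' : Proc} (h : TauStar P P') : TauStar (nuN n P) (nuN n P') := by
  induction n generalizing P P' with
  | zero => exact h
  | succ n ih => exact ih h.nu

theorem rename (f : Name → Name) {P P' : Proc} (h : TauStar P P') :
    TauStar (P.rename f) (P'.rename f) := by
  refine h.map (fun P => P.rename f) (fun _ _ t => ?_)
  have := t.rename f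
  rwa [Act.bn, liftN_zero] at this

end TauStar

namespace WeakTrans

theorem single {P P' : Proc} {μ : Act} (t : Trans P μ P') : WeakTrans P μ P' :=
  ⟨_, _, .refl _, t, .refl _⟩

theorem tauStar {P P' : Proc} (h : WeakTrans P .tau P') : TauStar P P' := by
  obtain ⟨P₁, P₂, h₁, t, h₂⟩ := h
  exact (h₁.trans (.single t)).trans h₂

theorem parL {P P' : Proc} {μ : Act} (Q : Proc) (h : WeakTrans P μ P') :
    WeakTrans (.par P Q) μ (.par P' (Q.shift μ.bn)) := by
  obtain ⟨P₁, P₂, h₁, t, h₂⟩ := h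
  exact ⟨_, _, h₁.parL Q, t.parL Q, h₂.parL _⟩

theorem parR {Q Q' : Proc} {μ : Act} (P : Proc) (h : WeakTrans Q μ Q') :
    WeakTrans (.par P Q) μ (.par (P.shift μ.bn) Q') := by
  obtain ⟨P₁, P₂, h₁, t, h₂⟩ := h
  exact ⟨_, _, h₁.parR P, t.parR P, h₂.parR _⟩

theorem comL {P P' Q Q' : Proc} {a : Name} {n : ℕ} (h : WeakTrans P (.out a n) P')
    (h' : WeakTrans Q (.inp a n) Q') : WeakTrans (.par P Q) .tau (nuN n (.par P' Q')) := by
  obtain ⟨P₁, P₂, h₁, t, h₂⟩ := h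
  obtain ⟨Q₁, Q₂, h₁', t', h₂'⟩ := h'
  exact ⟨_, _, h₁.par h₁', .comL t t', (h₂.par h₂').nuN n⟩

theorem comR {P P' Q Q' : Proc} {a : Name} {n : ℕ} (h : WeakTrans P (.inp a n) P')
    (h' : WeakTrans Q (.out a n) Q') : WeakTrans (.par P Q) .tau (nuN n (.par P' Q')) := by
  obtain ⟨P₁, P₂, h₁, t, h₂⟩ := h
  obtain ⟨Q₁, Q₂, h₁', t', h₂'⟩ := h'
  exact ⟨_, _, h₁.par h₁', .comR t t', (h₂.par h₂').nuN n⟩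

theorem res {P P' : Proc} {μ : Act} (h : WeakTrans P (μ.rename Nat.succ) P') :
    WeakTrans (.nu P) μ (.nu (P'.rename (rot μ.bn))) := by
  obtain ⟨P₁, P₂, h₁, t, h₂⟩ := h
  exact ⟨_, _, h₁.nu, .res t, (h₂.rename _).nu⟩

theorem rename (f : Name → Name) {P P' : Proc} {μ : Act} (h : WeakTrans P μ P') :
    WeakTrans (P.rename f) (μ.rename f) (P'.rename (liftN μ.bn f)) := by
  obtain ⟨P₁, P₂, h₁, t, h₂⟩ := h
  exact ⟨_, _, h₁.rename f, t.rename f, h₂.rename _⟩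

end WeakTrans

/-! ## Expansion up to expansion, structural laws and contexts -/

/-- The two clauses of an expansion relation at the pair `(P, Q)`, with derivatives in `S`. -/
def Progress (S : Proc → Proc → Prop) (P Q : Proc) : Prop :=
  (∀ μ P', Trans P μ P' → ∃ Q', OptTrans Q μ Q' ∧ S P' Q') ∧
    (∀ μ Q', Trans Q μ Q' → ∃ P', WeakTrans P μ P' ∧ S P' Q')

theorem Progress.mono {S T : Proc → Proc → Prop} (h : ∀ P Q, S P Q → T P Q) {P Q : Proc}
    (hp : Progress S P Q) : Progress T P Q :=
  ⟨fun μ P' t => let ⟨Q', u, s⟩ := hp.1 μ P' t; ⟨Q', u, h _ _ s⟩,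
    fun μ Q' t => let ⟨P', u, s⟩ := hp.2 μ Q' t; ⟨P', u, h _ _ s⟩⟩

theorem Expands.progress {P Q : Proc} (h : Expands P Q) : Progress Expands P Q := by
  obtain ⟨R, hR, h⟩ := h
  exact Progress.mono (fun _ _ h => ⟨R, hR, h⟩) (hR _ _ h)

theorem Expands.tauStar {P Q Q' : Proc} (h : Expands P Q) (t : TauStar Q Q') :
    ∃ P', TauStar P P' ∧ Expands P' Q' := by
  induction t with
  | refl => exact ⟨P, .refl P, h⟩
  | tail _ t ih =>
    obtain ⟨P₁, u, h₁⟩ := ih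
    obtain ⟨P₂, u', h₂⟩ := h₁.progress.2 _ _ t
    exact ⟨P₂, u.trans u'.tauStar, h₂⟩

theorem Expands.weakTrans {P Q Q' : Proc} {μ : Act} (h : Expands P Q) (t : WeakTrans Q μ Q') :
    ∃ P', WeakTrans P μ P' ∧ Expands P' Q' := by
  obtain ⟨Q₁, Q₂, t₁, t, t₂⟩ := t
  obtain ⟨P₁, u₁, h₁⟩ := h.tauStar t₁
  obtain ⟨P₂, ⟨P₃, P₄, u₂, u, u₃⟩, h₂⟩ := h₁.progress.2 _ _ t
  obtain ⟨P₅, u₄, h₃⟩ := h₂.tauStar t₂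
  exact ⟨P₅, ⟨P₃, P₄, u₁.trans u₂, u, u₃.trans u₄⟩, h₃⟩

/-- The closure of `R` under contexts, injective renamings, expansion on the left and structural
laws on the right. -/
inductive UpTo (R : Proc → Proc → Prop) : Proc → Proc → Prop where
  | base {P Q : Proc} : R P Q → UpTo R P Q
  | refl (P : Proc) : UpTo R P P
  | par {P Q P' Q' : Proc} : UpTo R P Q → UpTo R P' Q' → UpTo R (.par P P') (.par Q Q')
  | nu {P Q : Proc} : UpTo R P Q → UpTo R (.nu P) (.nu Q)
  | inp (a : Name) (n : ℕ) {P Q : Proc} : UpTo R P Q → UpTo R (.inp a n P) (.inp a n Q)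
  | out (a : Name) (n : ℕ) {P Q : Proc} : UpTo R P Q → UpTo R (.out a n P) (.out a n Q)
  | rep (a : Name) (n : ℕ) {P Q : Proc} : UpTo R P Q → UpTo R (.rep a n P) (.rep a n Q)
  | rename {P Q : Proc} {f : Name → Name} (hf : f.Injective) :
      UpTo R P Q → UpTo R (P.rename f) (Q.rename f)
  | trans {P P₁ Q₁ Q : Proc} : Expands P P₁ → UpTo R P₁ Q₁ → Cong Q₁ Q → UpTo R P Q

namespace UpTo

variable {R : Proc → Proc → Prop}

theorem shift (n : ℕ) {P Q : Proc} (h : UpTo R P Q) : UpTo R (P.shift n) (Q.shift n) :=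
  h.rename (add_injective n)

theorem nuN (n : ℕ) {P Q : Proc} (h : UpTo R P Q) : UpTo R (nuN n P) (nuN n Q) := by
  induction n generalizing P Q with
  | zero => exact h
  | succ n ih => exact ih h.nu

theorem progress_par {P Q P' Q' : Proc} (h : UpTo R P Q) (h' : UpTo R P' Q')
    (ih : Progress (UpTo R) P Q) (ih' : Progress (UpTo R) P' Q') :
    Progress (UpTo R) (.par P P') (.par Q Q') := by
  constructor
  · intro μ X t
    replace t := t.par_inv
    obtain ⟨P₁, t, rfl⟩ | ⟨P₁, t, rfl⟩ | ⟨rfl, a, n, P₁, P₁', t, t', rfl⟩ |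
      ⟨rfl, a, n, P₁, P₁', t, t', rfl⟩ := t
    · obtain ⟨Q₁, u | ⟨rfl, rfl⟩, r⟩ := ih.1 _ _ t
      · exact ⟨_, .inl (.parL _ u), r.par (h'.shift _)⟩
      · exact ⟨_, .inr ⟨rfl, rfl⟩, r.par (by rwa [Act.bn, shift_zero])⟩
    · obtain ⟨Q₁, u | ⟨rfl, rfl⟩, r⟩ := ih'.1 _ _ t
      · exact ⟨_, .inl (.parR _ u), (h.shift _).par r⟩
      · exact ⟨_, .inr ⟨rfl, rfl⟩, UpTo.par (by rwa [Act.bn, shift_zero]) r⟩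
    -- The two synchronising actions are visible, so neither can be answered by standing still.
    · obtain ⟨Q₁, u | ⟨e, _⟩, r⟩ := ih.1 _ _ t
      · obtain ⟨Q₁', u' | ⟨e, _⟩, r'⟩ := ih'.1 _ _ t'
        · exact ⟨_, .inl (.comL u u'), (r.par r').nuN n⟩
        · cases e
      · cases e
    · obtain ⟨Q₁, u | ⟨e, _⟩, r⟩ := ih.1 _ _ t
      · obtain ⟨Q₁', u' | ⟨e, _⟩, r'⟩ := ih'.1 _ _ t'
        · exact ⟨_, .inl (.comR u u'), (r.par r').nuN n⟩
        · cases e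
      · cases e
  · intro μ X t
    replace t := t.par_inv
    obtain ⟨Q₁, t, rfl⟩ | ⟨Q₁, t, rfl⟩ | ⟨rfl, a, n, Q₁, Q₁', t, t', rfl⟩ |
      ⟨rfl, a, n, Q₁, Q₁', t, t', rfl⟩ := t
    · obtain ⟨P₁, u, r⟩ := ih.2 _ _ t
      exact ⟨_, u.parL _, r.par (h'.shift _)⟩
    · obtain ⟨P₁, u, r⟩ := ih'.2 _ _ t
      exact ⟨_, u.parR _, (h.shift _).par r⟩
    · obtain ⟨P₁, u, r⟩ := ih.2 _ _ t
      obtain ⟨P₁', u', r'⟩ := ih'.2 _ _ t'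
      exact ⟨_, u.comL u', (r.par r').nuN n⟩
    · obtain ⟨P₁, u, r⟩ := ih.2 _ _ t
      obtain ⟨P₁', u', r'⟩ := ih'.2 _ _ t'
      exact ⟨_, u.comR u', (r.par r').nuN n⟩

theorem progress_nu {P Q : Proc} (ih : Progress (UpTo R) P Q) :
    Progress (UpTo R) (.nu P) (.nu Q) := by
  constructor
  · intro μ X t
    replace t := t.nu_inv
    obtain ⟨P₁, t, rfl⟩ := t
    obtain ⟨Q₁, u | ⟨e, rfl⟩, r⟩ := ih.1 _ _ t
    · exact ⟨_, .inl (.res u), (r.rename (rot_injective _)).nu⟩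
    · rw [Act.rename_eq_tau] at e
      subst e
      exact ⟨_, .inr ⟨rfl, rfl⟩, by rw [Act.bn, rename_rot_zero]; exact r.nu⟩
  · intro μ X t
    replace t := t.nu_inv
    obtain ⟨Q₁, t, rfl⟩ := t
    obtain ⟨P₁, u, r⟩ := ih.2 _ _ t
    exact ⟨_, u.res, (r.rename (rot_injective _)).nu⟩

theorem progress_rename {P Q : Proc} {f : Name → Name} (hf : f.Injective)
    (ih : Progress (UpTo R) P Q) : Progress (UpTo R) (P.rename f) (Q.rename f) := by
  constructor
  · intro μ X t
    replace t := t.of_rename hf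
    obtain ⟨μ, P₁, rfl, rfl, t⟩ := t
    obtain ⟨Q₁, u | ⟨rfl, rfl⟩, r⟩ := ih.1 _ _ t
    · exact ⟨_, .inl (u.rename f), r.rename (liftN_injective _ hf)⟩
    · exact ⟨_, .inr ⟨rfl, rfl⟩, by rw [Act.bn, liftN_zero]; exact r.rename hf⟩
  · intro μ X t
    replace t := t.of_rename hf
    obtain ⟨μ, Q₁, rfl, rfl, t⟩ := t
    obtain ⟨P₁, u, r⟩ := ih.2 _ _ t
    exact ⟨_, u.rename f, r.rename (liftN_injective _ hf)⟩

/-- The two sides differ for a reason. A challenge of `Q` has to reach `Q₁` as a single step,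
because the hypothesis answers only single steps; a strong bisimulation ensures this. On the left,
expansion transports the resulting weak transition back to `P`. -/
theorem progress_trans {P P₁ Q₁ Q : Proc} (h : Expands P P₁) (hr : UpTo R P₁ Q₁)
    (hc : Cong Q₁ Q) (ih : Progress (UpTo R) P₁ Q₁) : Progress (UpTo R) P Q := by
  constructor
  · intro μ P' t
    obtain ⟨P₁', u | ⟨rfl, rfl⟩, h'⟩ := h.progress.1 _ _ t
    · obtain ⟨Q₁', v | ⟨rfl, rfl⟩, r⟩ := ih.1 _ _ u
      · obtain ⟨Q', w, hw⟩ := hc.matches _ _ v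
        exact ⟨Q', .inl w, .trans h' r hw⟩
      · exact ⟨Q, .inr ⟨rfl, rfl⟩, .trans h' r hc⟩
    · exact ⟨Q, .inr ⟨rfl, rfl⟩, .trans h' hr hc⟩
  · intro μ Q' t
    obtain ⟨Q₁', u, hu⟩ := hc.symm.matches _ _ t
    obtain ⟨P₁', v, r⟩ := ih.2 _ _ u
    obtain ⟨P', w, h'⟩ := h.weakTrans v
    exact ⟨P', w, .trans h' r hu.symm⟩

end UpTo

theorem Progress.prefix {S : Proc → Proc → Prop} {P Q P' Q' : Proc} {μ : Act}
    (hP : ∀ ν X, Trans P ν X → ν = μ ∧ X = P') (hQ : ∀ ν X, Trans Q ν X → ν = μ ∧ X = Q')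
    (tP : Trans P μ P') (tQ : Trans Q μ Q') (h : S P' Q') : Progress S P Q := by
  constructor
  · intro ν X t
    obtain ⟨rfl, rfl⟩ := hP _ _ t
    exact ⟨_, .inl tQ, h⟩
  · intro ν X t
    obtain ⟨rfl, rfl⟩ := hQ _ _ t
    exact ⟨_, .single tP, h⟩

theorem Progress.refl {S : Proc → Proc → Prop} (hS : ∀ P, S P P) (P : Proc) : Progress S P P :=
  ⟨fun _ _ t => ⟨_, .inl t, hS _⟩, fun _ _ t => ⟨_, .single t, hS _⟩⟩

/-- By induction on the closure; only the base pairs have to be checked by hand, and their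
derivatives may lie anywhere in the closure. -/
theorem UpTo.progress {R : Proc → Proc → Prop} (hR : ∀ P Q, R P Q → Progress (UpTo R) P Q)
    {P Q : Proc} (h : UpTo R P Q) : Progress (UpTo R) P Q := by
  induction h with
  | base h => exact hR _ _ h
  | refl P => exact .refl .refl P
  | par h h' ih ih' => exact progress_par h h' ih ih'
  | nu _ ih => exact progress_nu ih
  | inp a n h _ =>
    exact .prefix (fun _ _ t => t.inp_inv) (fun _ _ t => t.inp_inv) (.inp _ _ _) (.inp _ _ _) h
  | out a n h _ =>
    exact .prefix (fun _ _ t => t.out_inv) (fun _ _ t => t.out_inv) (.out _ _ _) (.out _ _ _) h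
  | rep a n h _ =>
    exact .prefix (fun _ _ t => t.rep_inv) (fun _ _ t => t.rep_inv) (.rep _ _ _) (.rep _ _ _)
      (h.par ((h.rep a n).shift n))
  | rename hf _ ih => exact progress_rename hf ih
  | trans h hr hc ih => exact progress_trans h hr hc ih

theorem UpTo.expands {R : Proc → Proc → Prop} (hR : ∀ P Q, R P Q → Progress (UpTo R) P Q)
    {P Q : Proc} (h : UpTo R P Q) : Expands P Q :=
  ⟨UpTo R, fun _ _ h => h.progress hR, h⟩

/-! ### Expansion is a precongruence -/

namespace Expands

/-- With expansion itself as the base, each precongruence law below is a constructor of `UpTo`. -/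
theorem base_progress (P Q : Proc) (h : Expands P Q) : Progress (UpTo Expands) P Q :=
  h.progress.mono fun _ _ => .base

theorem of_upTo {P Q : Proc} (h : UpTo Expands P Q) : Expands P Q := h.expands base_progress

theorem refl (P : Proc) : Expands P P := of_upTo (.refl P)

theorem par {P Q P' Q' : Proc} (h : Expands P Q) (h' : Expands P' Q') :
    Expands (.par P P') (.par Q Q') :=
  of_upTo (.par (.base h) (.base h'))

theorem parL {P Q : Proc} (R : Proc) (h : Expands P Q) : Expands (.par P R) (.par Q R) :=
  h.par (refl R)

theorem parR {P Q : Proc} (R : Proc) (h : Expands P Q) : Expands (.par R P) (.par R Q) :=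
  (refl R).par h

theorem nu {P Q : Proc} (h : Expands P Q) : Expands (.nu P) (.nu Q) :=
  of_upTo (.nu (.base h))

theorem inp (a : Name) (n : ℕ) {P Q : Proc} (h : Expands P Q) :
    Expands (.inp a n P) (.inp a n Q) :=
  of_upTo (.inp a n (.base h))

theorem out (a : Name) (n : ℕ) {P Q : Proc} (h : Expands P Q) :
    Expands (.out a n P) (.out a n Q) :=
  of_upTo (.out a n (.base h))

theorem rep (a : Name) (n : ℕ) {P Q : Proc} (h : Expands P Q) :
    Expands (.rep a n P) (.rep a n Q) :=
  of_upTo (.rep a n (.base h))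

theorem rename {P Q : Proc} {f : Name → Name} (hf : f.Injective) (h : Expands P Q) :
    Expands (P.rename f) (Q.rename f) :=
  of_upTo (.rename hf (.base h))

theorem of_cong {P Q : Proc} (h : Cong P Q) : Expands P Q :=
  of_upTo (.trans (refl P) (.refl P) h)

theorem trans {P Q R : Proc} (h : Expands P Q) (h' : Expands Q R) : Expands P R :=
  of_upTo (.trans h (.base h') (.refl R))

/-- A process expands its only derivative. -/
theorem of_unique_tau {P P' : Proc} (t : Trans P .tau P')
    (h : ∀ μ X, Trans P μ X → μ = .tau ∧ X = P') : Expands P P' := by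
  -- One pair is added to expansion: the step of `P` is answered by standing still, and a step of
  -- `P'` by the `τ` followed by that step.
  refine ⟨fun A B => Expands A B ∨ (A = P ∧ B = P'), ?_, .inr ⟨rfl, rfl⟩⟩
  rintro A B (hAB | ⟨rfl, rfl⟩)
  · exact hAB.progress.mono fun _ _ => .inl
  · constructor
    · intro μ X u
      obtain ⟨rfl, rfl⟩ := h _ _ u
      exact ⟨_, .inr ⟨rfl, rfl⟩, .inl (refl _)⟩
    · intro μ X u
      exact ⟨X, ⟨_, _, .single t, u, .refl _⟩, .inl (refl X)⟩

/-- Communication with a restricted server. -/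
theorem call_rep (n : ℕ) (P B : Proc) :
    Expands (.nu (.par (.out 0 n P) (.rep 0 n B)))
      (.nu (.par (nuN n (.par P B)) (.rep 0 n B))) := by
  have key : Expands (.nu (.par (.out 0 n P) (.rep 0 n B)))
      (.nu (nuN n (.par P (.par B ((Proc.rep 0 n B).shift n))))) := by
    refine of_unique_tau (.server_call B (.out 0 n P)) fun μ X t => ?_
    replace t := t.server_inv
    obtain ⟨P', t, rfl⟩ | ⟨rfl, P', t, rfl⟩ := t
    · replace t := t.out_inv
      obtain ⟨e, rfl⟩ := t
      cases μ <;> simp [Act.rename] at e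
    · replace t := t.out_inv
      obtain ⟨-, rfl⟩ := t
      exact ⟨rfl, rfl⟩
  exact key.trans (of_cong (.server_call P B n))

/-- Communication with a restricted linear input. -/
theorem call_inp (n : ℕ) (P B : Proc) :
    Expands (.nu (.par (.out 0 n P) (.inp 0 n B))) (.nu (nuN n (.par P B))) := by
  refine of_unique_tau (.res_tau (.comL (.out 0 n P) (.inp 0 n B))) fun μ X t => ?_
  replace t := t.nu_inv
  obtain ⟨X, t, rfl⟩ := t
  replace t := t.par_inv
  obtain ⟨P', t, rfl⟩ | ⟨Q', t, rfl⟩ | ⟨h, b, k, P', Q', t, t', rfl⟩ |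
    ⟨h, b, k, P', Q', t, t', rfl⟩ := t
  · have := t.out_inv.1
    cases μ <;> simp [Act.rename] at this
  · have := t.inp_inv.1
    cases μ <;> simp [Act.rename] at this
  · replace t := t.out_inv
    obtain ⟨e, rfl⟩ := t
    replace t' := t'.inp_inv
    obtain ⟨-, rfl⟩ := t'
    cases e
    rw [Act.rename_eq_tau] at h
    subst h
    exact ⟨rfl, by rw [Act.bn, rename_rot_zero]⟩
  · simpa using t.out_inv.1

end Expands

end CbvPiI

/-! ### Calls through forwarders and chains of forwarders. -/

namespace CbvPiI

open Proc

/-! ## Structural laws in derived form -/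

namespace Cong

/-- Scope extrusion of the left component. -/
theorem nu_par_left {P Q R : Proc} (h : R = Q.shift 1) : Cong (.nu (.par P R)) (.par (.nu P) Q) :=
  h ▸ (nu_par P Q).symm

/-- Scope extrusion of the right component. -/
theorem nu_par_right {P Q R : Proc} (h : P = Q.shift 1) : Cong (.nu (.par P R)) (.par Q (.nu R)) :=
  h ▸ (par_nu Q R).symm

/-- Garbage collection of an inaccessible resource. -/
theorem nu_gc {P P' Q : Proc} (hQ : Inert Q) (h : P = P'.shift 1) : Cong (.nu (.par P Q)) P' :=
  (nu_par_right h).trans (((nu_inert hQ).parR _).trans (par_nil _))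

theorem nu_unused {P P' : Proc} (h : P = P'.shift 1) : Cong (.nu P) P' :=
  (par_nil _).symm.nu.trans (nu_gc .nil h)

theorem nu_swap' {P Q : Proc} (h : P.rename (rot 1) = Q) : Cong (.nu (.nu P)) (.nu (.nu Q)) :=
  h ▸ nu_swap P

theorem push_out' {a : Name} {n : ℕ} {P P' Q Q' : Proc} (hQ : Inert Q)
    (hP' : P.rename (rot n) = P') (hQ' : (Q.shift n).rename (rot n) = Q') :
    Cong (.nu (.par (.out (a + 1) n P) Q)) (.out a n (.nu (.par P' Q'))) := by
  subst hP' hQ'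
  exact push_out a n P hQ

theorem push_inp' {a : Name} {n : ℕ} {P P' Q Q' : Proc} (hQ : Inert Q)
    (hP' : P.rename (rot n) = P') (hQ' : (Q.shift n).rename (rot n) = Q') :
    Cong (.nu (.par (.inp (a + 1) n P) Q)) (.inp a n (.nu (.par P' Q'))) := by
  subst hP' hQ'
  exact push_inp a n P hQ

theorem push_rep' {a : Name} {n m : ℕ} {P P' B Q' : Proc} (hP : NoInp n P) (hB : NoInp m B)
    (hP' : P.rename (rot n) = P') (hQ' : ((Proc.rep 0 m B).shift n).rename (rot n) = Q') :
    Cong (.nu (.par (.rep (a + 1) n P) (.rep 0 m B))) (.rep a n (.nu (.par P' Q'))) := by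
  subst hP' hQ'
  exact push_rep a n hP hB

end Cong

theorem Expands.trans_cong {P Q R : Proc} (h : Expands P Q) (h' : Cong Q R) : Expands P R :=
  h.trans (.of_cong h')

theorem Cong.trans_expands {P Q R : Proc} (h : Cong P Q) (h' : Expands Q R) : Expands P R :=
  (Expands.of_cong h).trans h'

theorem Proc.rename_congr (P : Proc) {f g : Name → Name} (h : ∀ i, f i = g i) :
    P.rename f = P.rename g := by
  rw [funext h]

/-! ## Forwarders -/

/-- A call through the value forwarder `x ▷ y`. -/
theorem Expands.call_link_val (Z : Proc) (y p : Name) :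
    Expands
      (.nu (.par (.out 0 2 (.par (Z.rename (liftN 1 (· + 2))) (.link .cont 1 (p + 3))))
        (.link .val 0 (y + 1))))
      (.nu (.par Z (.out (y + 1) 2
        (.par (.link .val 0 2) (.nu (.par (.link .cont 2 0) (.link .cont 0 (p + 4)))))))) := by
  refine ((Cong.link _ _ _).parR _).nu.trans_expands ((Expands.call_rep _ _ _).trans_cong ?_)
  -- No other component mentions the name of the forwarder once the call is made, so the forwarder
  -- is garbage.
  refine (Cong.nu_gc (P' := .nu (.nu (.par (.par (Z.rename (liftN 1 (· + 1)))
    (.link .cont 1 (p + 2))) (.out (y + 2) 2 (.par (.link .val 0 2) (.link .cont 1 3))))))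
    (.rep _ _) ?_).trans ?_
  · simp only [nuN, Proc.rename, shift, rename_rename, liftN_one_liftN]
    congr 4
    refine Proc.rename_congr _ fun i => ?_
    cases i <;> simp [liftN]
  refine (Cong.nu_swap' (Q := .par (.par (Z.shift 1) (.link .cont 0 (p + 2)))
    (.out (y + 2) 2 (.par (.link .val 0 3) (.link .cont 1 2)))) ?_).trans ?_
  · simp only [Proc.rename, rename_rename, shift]
    congr 2
    refine Proc.rename_congr _ fun i => ?_
    cases i <;> simp [liftN, rot]
  refine Cong.nu ((Cong.par_assoc _ _ _).nu.trans ((Cong.nu_par_right rfl).trans (Cong.parR _ ?_)))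
  -- The forwarder `q ▷ p` waits at the restricted `q`, whose only other occurrence is below the
  -- output; hence it moves there.
  refine (Cong.par_comm _ _).nu.trans ((Cong.push_out' (Inert.link _ _) rfl rfl).trans
    (Cong.out _ _ ?_))
  refine (Cong.par_assoc _ _ _).nu.trans ?_
  exact Cong.nu_par_right rfl

/-- An output to the continuation forwarder `q ▷ p`. -/
theorem Expands.call_link_cont {Z : Proc} (hZ : Inert Z) (p : Name) :
    Expands (.nu (.par (.out 0 1 (Z.rename (liftN 1 (· + 1)))) (.link .cont 0 (p + 1))))
      (.out p 1 (.nu (.par (.link .val 1 0) (Z.rename (liftN 1 (· + 1)))))) := by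
  refine ((Cong.link _ _ _).parR _).nu.trans_expands ((Expands.call_inp _ _ _).trans_cong ?_)
  refine (Cong.nu_swap' (Q := .par (Z.shift 1) (.out (p + 2) 1 (.link .val 0 2))) ?_).trans ?_
  · simp only [Proc.rename, rename_rename, shift]
    congr 1
    refine Proc.rename_congr _ fun i => ?_
    cases i <;> simp [liftN, rot]
  refine (Cong.nu (Q := .par (.out (p + 1) 1 (.link .val 0 1)) Z) ?_).trans ?_
  · exact (Cong.nu_unused (P' := .par Z (.out (p + 1) 1 (.link .val 0 1))) rfl).trans
      (Cong.par_comm _ _)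
  -- The resource `Z` offers only inputs at its restricted name, so it moves below the output as
  -- well.
  refine (Cong.push_out' hZ rfl rfl).trans (.of_eq ?_)
  rw [shift_rename_rot]
  rfl

/-- Progress of two replicated inputs whose bodies are related. -/
theorem Progress.of_rep {R : Proc → Proc → Prop} {P Q A A' : Proc} {a : Name} {n : ℕ}
    (hP : Cong P (.rep a n A)) (hQ : Cong Q (.rep a n A')) (hR : UpTo R P Q)
    (h : UpTo R A A') : Progress (UpTo R) P Q := by
  -- The replications that survive the input are the original pair, related by `hR`; beside them run
  -- the two bodies.
  have key : UpTo R (.par A (P.shift n)) (.par A' (Q.shift n)) := h.par (hR.shift n)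
  constructor
  · intro μ X t
    obtain ⟨Y, u, hY⟩ := hP.matches _ _ t
    obtain ⟨rfl, rfl⟩ := u.rep_inv
    obtain ⟨Q', v, hQ'⟩ := hQ.symm.matches _ _ (.rep _ _ _)
    exact ⟨Q', .inl v, .trans (.of_cong (hY.trans ((hP.symm.shift n).parR _))) key
      (((hQ.shift n).parR _).trans hQ')⟩
  · intro μ X t
    obtain ⟨Y, u, hY⟩ := hQ.matches _ _ t
    obtain ⟨rfl, rfl⟩ := u.rep_inv
    obtain ⟨P', v, hP'⟩ := hP.symm.matches _ _ (.rep _ _ _)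
    exact ⟨P', .single v, .trans (.of_cong (hP'.symm.trans ((hP.symm.shift n).parR _))) key
      (((hQ.shift n).parR _).trans hY.symm)⟩

/-- Progress of two inputs whose bodies are related. -/
theorem Progress.of_inp {R : Proc → Proc → Prop} {P Q A A' : Proc} {a : Name} {n : ℕ}
    (hP : Cong P (.inp a n A)) (hQ : Cong Q (.inp a n A'))
    (h : UpTo R A A') : Progress (UpTo R) P Q := by
  constructor
  · intro μ X t
    obtain ⟨Y, u, hY⟩ := hP.matches _ _ t
    obtain ⟨rfl, rfl⟩ := u.inp_inv
    obtain ⟨Q', v, hQ'⟩ := hQ.symm.matches _ _ (.inp _ _ _)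
    exact ⟨Q', .inl v, .trans (.of_cong hY) h hQ'⟩
  · intro μ X t
    obtain ⟨Y, u, hY⟩ := hQ.matches _ _ t
    obtain ⟨rfl, rfl⟩ := u.inp_inv
    obtain ⟨P', v, hP'⟩ := hP.symm.matches _ _ (.inp _ _ _)
    exact ⟨P', .single v, .trans (.of_cong hP'.symm) h hY.symm⟩

/-- Two forwarders in a chain, and the forwarder that replaces them. -/
inductive Chain : Proc → Proc → Prop where
  | mk (k : Link) (a b : Name) :
      Chain (.nu (.par (.link k (a + 1) 0) (.link k 0 (b + 1)))) (.link k a b)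

/-- After the input at `a` the first forwarder calls the second. Performing this call yields an
output towards `b` whose continuation consists of new chains: one for values and one for
continuations, or a single one for values. They lie below prefixes and in parallel, which is where
the closure under contexts is needed. -/
theorem Chain.progress : ∀ P Q, Chain P Q → Progress (UpTo Chain) P Q := by
  rintro _ _ ⟨k, a, b⟩
  cases k with
  | val =>
    refine Progress.of_rep (A := .nu (.par (.out 0 2 (.par (.link .val 0 3) (.link .cont 1 4)))
      (.rep 0 2 (.out (b + 5) 2 (.par (.link .val 0 2) (.link .cont 1 3))))))
      (((Cong.link _ _ _).par (Cong.link _ _ _)).nu.trans (Cong.push_rep' ?_ ?_ rfl rfl))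
      (Cong.link _ _ _) (.base ⟨.val, a, b⟩) ?_
    · simp [NoInp]
    · simp [NoInp]
    refine .trans (Q₁ := .out (b + 2) 2 (.par (.link .val 0 2) (.link .cont 1 3)))
      (P₁ := .out (b + 2) 2 (.par (.nu (.par (.link .val 1 0) (.link .val 0 3)))
        (.nu (.par (.link .cont 2 0) (.link .cont 0 4)))))
      ?_ (.out _ _ (.par (.base ⟨.val, 0, 2⟩) (.base ⟨.cont, 1, 3⟩))) (.refl _)
    refine ((Cong.link .val 0 (b + 3)).symm.parR _).nu.trans_expands
      ((Expands.call_link_val (.link .val 0 1) (b + 2) 1).trans_cong ?_)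
    refine (Cong.par_comm _ _).nu.trans ((Cong.push_out' (.link _ _) rfl rfl).trans (.out _ _ ?_))
    exact (Cong.par_right_comm _ _ _).nu.trans (Cong.nu_par_left rfl)
  | cont =>
    refine Progress.of_inp (A := .nu (.par (.out 0 1 (.link .val 0 2)) (.link .cont 0 (b + 2))))
      (((Cong.link .cont (a + 1) 0).parL _).nu.trans (Cong.push_inp' (.link _ _) rfl rfl))
      (Cong.link _ _ _) ?_
    exact .trans (Expands.call_link_cont (.link .val 1) (b + 1))
      (.out _ _ (.base ⟨.val, 0, 1⟩)) (.refl _)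

/-- `ν b (a ▷ b | b ▷ c)` expands `a ▷ c`. -/
theorem Expands.link_trans (k : Link) (a c : Name) :
    Expands (.nu (.par (.link k (a + 1) 0) (.link k 0 (c + 1)))) (.link k a c) :=
  UpTo.expands Chain.progress (.base ⟨k, a, c⟩)

end CbvPiI

/-! ### Syntactic properties of terms and of the encoding. -/

namespace CbvPiI

open Proc

/-! ## Terms: renaming, substitution and size -/

namespace Term

theorem upr_id : upr id = id := by funext i; cases i <;> rfl

theorem rename_id (M : Term) : M.rename id = M := by
  induction M <;> simp_all [rename, upr_id]

theorem upr_comp (g f : ℕ → ℕ) : upr g ∘ upr f = upr (g ∘ f) := by funext i; cases i <;> rfl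

theorem rename_rename (M : Term) (f g : ℕ → ℕ) : (M.rename f).rename g = M.rename (g ∘ f) := by
  induction M generalizing f g <;> simp_all [rename, upr_comp]

theorem ups_var : ups var = var := by funext i; cases i <;> rfl

theorem subst_var (M : Term) : M.subst var = M := by
  induction M <;> simp_all [subst, ups_var]

theorem isValue_rename (M : Term) (f : ℕ → ℕ) : (M.rename f).isValue = M.isValue := by
  cases M <;> rfl

/-- The number of constructors of a term. -/
def size : Term → ℕ
  | var _ => 1
  | lam M => M.size + 1
  | app M N => M.size + N.size + 1

theorem size_rename (M : Term) (f : ℕ → ℕ) : (M.rename f).size = M.size := by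
  induction M generalizing f <;> simp_all [rename, size]

/-- Size `1` characterises variables. This invariance makes the induction behind
`forwards_of_isValue` terminate. -/
theorem size_subst (M : Term) {s : ℕ → Term} (h : ∀ i, (s i).size = 1) :
    (M.subst s).size = M.size := by
  induction M generalizing s with
  | var x => exact h x
  | lam M ih =>
    refine congrArg (· + 1) (ih fun i => ?_)
    cases i with
    | zero => rfl
    | succ i => exact (size_rename _ _).trans (h i)
  | app M N ihM ihN => simp only [subst, size, ihM h, ihN h]

end Term

/-! ## The encoding: renaming, input names -/

theorem Env.liftN_comp_up (ρ : Env) (n : ℕ) (f : Name → Name) :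
    liftN n f ∘ ρ.up n = Env.up (f ∘ ρ) n := by
  funext i; simp [Env.up, liftN]

theorem Env.liftN_comp_bind (ρ : Env) (f : Name → Name) :
    liftN 2 f ∘ ρ.bind = Env.bind (f ∘ ρ) := by
  funext i; cases i <;> simp [Env.bind, liftN]

theorem Env.bind_comp_upr (ρ : Env) (g : ℕ → ℕ) : ρ.bind ∘ Term.upr g = Env.bind (ρ ∘ g) := by
  funext i; cases i <;> rfl

/-- Case analysis on an application along the clauses of the encoding. -/
@[elab_as_elim]
theorem Term.app_cases {C : Term → Term → Prop}
    (var_value : ∀ x V, V.isValue → C (.var x) V)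
    (lam_value : ∀ L V, V.isValue → C (.lam L) V)
    (value_app : ∀ V N, V.isValue → N.isValue = false → C V N)
    (app_value : ∀ M V, M.isValue = false → V.isValue → C M V)
    (app_app : ∀ M N, M.isValue = false → N.isValue = false → C M N) (M N : Term) : C M N := by
  cases hN : N.isValue with
  | true =>
    cases M with
    | var x => exact var_value x N hN
    | lam L => exact lam_value L N hN
    | app A B => exact app_value _ N rfl hN
  | false =>
    cases hM : M.isValue with
    | true => exact value_app M N hM hN
    | false => exact app_app M N hM hN

theorem optEnc_rename_both (M : Term) :
    (∀ (ρ : Env) (p : Name) (f : Name → Name),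
      (optEnc M ρ p).rename f = optEnc M (f ∘ ρ) (f p)) ∧
    (∀ (ρ : Env) (y : Name) (f : Name → Name),
      (optEncVal M ρ y).rename f = optEncVal M (f ∘ ρ) (f y)) := by
  induction M with
  | var x => constructor <;> intros <;> simp [optEnc, optEncVal, enc, Proc.rename, liftN]
  | lam M ih =>
    constructor
    · intro ρ p f
      rw [optEnc_value rfl, optEnc_value rfl, optEncVal_lam, optEncVal_lam]
      simp only [Proc.rename, ih.1, Env.liftN_comp_up, Env.liftN_comp_bind]
      rfl
    · intro ρ p f
      simp only [optEncVal_lam, Proc.rename, ih.1, Env.liftN_comp_bind]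
      rfl
  | app M N ihM ihN =>
    refine ⟨fun ρ p f => ?_, fun ρ y f => rfl⟩
    revert ihM ihN
    refine Term.app_cases ?_ ?_ ?_ ?_ ?_ M N
    · intro x V hV _ ih
      simp only [optEnc_var_value x hV, Proc.rename, ih.2, Env.liftN_comp_up]
      rfl
    · intro L V hV ih' ih
      simp only [optEnc_lam_value L hV, Proc.rename, ih.2, ih'.2, liftN_one_liftN, sendTo,
        Env.liftN_comp_up]
      rfl
    · intro V N hV hN ih' ih
      simp only [optEnc_value_app hV hN, Proc.rename, ih.1, ih'.2, liftN_one_liftN, sendTo,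
        Env.liftN_comp_up]
      rfl
    · intro M V hM hV ih' ih
      simp only [optEnc_app_value hM hV, Proc.rename, ih.2, ih'.1, liftN_one_liftN, sendTo,
        Env.liftN_comp_up]
      rfl
    · intro M N hM hN ih' ih
      simp only [optEnc_app_app hM hN, Proc.rename, ih.1, ih'.1, liftN_one_liftN, sendTo,
        Env.liftN_comp_up]
      rfl

theorem optEnc_rename (M : Term) (ρ : Env) (p : Name) (f : Name → Name) :
    (optEnc M ρ p).rename f = optEnc M (f ∘ ρ) (f p) :=
  (optEnc_rename_both M).1 ρ p f

theorem optEncVal_rename (M : Term) (ρ : Env) (y : Name) (f : Name → Name) :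
    (optEncVal M ρ y).rename f = optEncVal M (f ∘ ρ) (f y) :=
  (optEnc_rename_both M).2 ρ y f

theorem Env.up_comp (ρ : Env) (k : ℕ) (g : ℕ → ℕ) : Env.up (ρ ∘ g) k = ρ.up k ∘ g := rfl

theorem optEnc_term_rename_both (M : Term) :
    (∀ (ρ : Env) (p : Name) (g : ℕ → ℕ), optEnc (M.rename g) ρ p = optEnc M (ρ ∘ g) p) ∧
    (∀ (ρ : Env) (y : Name) (g : ℕ → ℕ), optEncVal (M.rename g) ρ y = optEncVal M (ρ ∘ g) y) := by
  induction M with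
  | var x => exact ⟨fun _ _ _ => rfl, fun _ _ _ => rfl⟩
  | lam M ih =>
    constructor
    · intro ρ p g
      rw [Term.rename, optEnc_value rfl, optEnc_value rfl, optEncVal_lam, optEncVal_lam, ih.1,
        Env.bind_comp_upr]
      rfl
    · intro ρ y g
      rw [Term.rename, optEncVal_lam, optEncVal_lam, ih.1, Env.bind_comp_upr]
  | app M N ihM ihN =>
    refine ⟨fun ρ p g => ?_, fun ρ y g => rfl⟩
    revert ihM ihN
    rw [Term.rename]
    refine Term.app_cases ?_ ?_ ?_ ?_ ?_ M N
    · intro x V hV _ ih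
      rw [Term.rename, optEnc_var_value x hV,
        optEnc_var_value _ (by rwa [Term.isValue_rename]), ih.2]
      rfl
    · intro L V hV ih' ih
      simp only [optEnc_lam_value L hV, Env.up_comp]
      rw [← ih'.2, ← ih.2]
      exact optEnc_lam_value _ (by rwa [Term.isValue_rename]) _ _
    · intro V N hV hN ih' ih
      simp only [optEnc_value_app hV hN, Env.up_comp]
      rw [← ih'.2, ← ih.1]
      exact optEnc_value_app (by rwa [Term.isValue_rename]) (by rwa [Term.isValue_rename]) _ _
    · intro M V hM hV ih' ih
      simp only [optEnc_app_value hM hV, Env.up_comp]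
      rw [← ih'.1, ← ih.2]
      exact optEnc_app_value (by rwa [Term.isValue_rename]) (by rwa [Term.isValue_rename]) _ _
    · intro M N hM hN ih' ih
      simp only [optEnc_app_app hM hN, Env.up_comp]
      rw [← ih'.1, ← ih.1]
      exact optEnc_app_app (by rwa [Term.isValue_rename]) (by rwa [Term.isValue_rename]) _ _

theorem optEncVal_term_rename (M : Term) (ρ : Env) (y : Name) (g : ℕ → ℕ) :
    optEncVal (M.rename g) ρ y = optEncVal M (ρ ∘ g) y :=
  (optEnc_term_rename_both M).2 ρ y g

/-- Names of lambda-variables are only called or used as targets of forwarders, and continuation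
names are only output at or targets. The sole free name at which an encoding may input is that of an
encoded value. This supplies the side conditions of the replication laws. -/
theorem noInp_both (M : Term) :
    (∀ (ρ : Env) (p k : Name), NoInp k (optEnc M ρ p)) ∧
    (∀ (ρ : Env) (y k : Name), y ≠ k → NoInp k (optEncVal M ρ y)) := by
  induction M with
  | var x => exact ⟨fun ρ p k => Nat.zero_ne_add_one k, fun ρ y k h => h⟩
  | lam M ih =>
    exact ⟨fun ρ p k => ⟨Nat.zero_ne_add_one k, ih.1 _ _ _⟩, fun ρ y k h => ⟨h, ih.1 _ _ _⟩⟩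
  | app M N ihM ihN =>
    refine ⟨fun ρ p k => ?_, fun ρ y k h => trivial⟩
    revert ihM ihN
    refine Term.app_cases ?_ ?_ ?_ ?_ ?_ M N
    · intro x V hV _ ih
      rw [optEnc_var_value x hV]
      exact ⟨ih.2 _ _ _ (by simp), by simp [NoInp]⟩
    · intro L V hV ih' ih
      rw [optEnc_lam_value L hV]
      exact ⟨ih'.2 _ _ _ (by simp), ih.2 _ _ _ (by simp), by simp [NoInp, sendTo]⟩
    · intro V N hV hN ih' ih
      rw [optEnc_value_app hV hN]
      exact ⟨ih'.2 _ _ _ (by simp), ih.1 _ _ _, by simp [NoInp, sendTo]⟩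
    · intro M V hM hV ih' ih
      rw [optEnc_app_value hM hV]
      exact ⟨ih'.1 _ _ _, by simp, ih.2 _ _ _ (by simp), by simp [NoInp, sendTo]⟩
    · intro M N hM hN ih' ih
      rw [optEnc_app_app hM hN]
      exact ⟨ih'.1 _ _ _, by simp, ih.1 _ _ _, by simp [NoInp, sendTo]⟩

theorem noInp_optEnc (M : Term) (ρ : Env) (p k : Name) : NoInp k (optEnc M ρ p) :=
  (noInp_both M).1 ρ p k

theorem noInp_optEncVal (M : Term) (ρ : Env) {y k : Name} (h : y ≠ k) :
    NoInp k (optEncVal M ρ y) :=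
  (noInp_both M).2 ρ y k h

theorem inert_optEncVal (M : Term) (ρ : Env) : Inert (optEncVal M ρ 0) := by
  cases M with
  | var x => exact .link _ _
  | lam M => exact .rep _ _
  | app M N => exact .nil

end CbvPiI

/-! ### Absorption of forwarders by encodings. -/

namespace CbvPiI

open Proc

/-! ## Servers -/

theorem Cong.push_nu {P P' Q Q' : Proc} (hP : P.rename (rot 1) = P')
    (hQ : (Q.shift 1).rename (rot 1) = Q') :
    Cong (.nu (.par (.nu P) Q)) (.nu (.nu (.par P' Q'))) := by
  subst hP hQ
  exact (nu_par _ _).nu.trans (nu_swap _)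

/-- A process that is, up to the structural laws, a replicated input at the name `0` which does
not receive at `0` elsewhere. -/
def IsServer (S : Proc) : Prop := ∃ m B, NoInp m B ∧ Cong S (.rep 0 m B)

namespace IsServer

variable {S : Proc}

theorem inert (hS : IsServer S) : Inert S := by
  obtain ⟨m, B, -, h⟩ := hS
  intro μ X t
  obtain ⟨Y, t, -⟩ := h.matches _ _ t
  exact ⟨m, t.rep_inv.1⟩

theorem dist (hS : IsServer S) {P Q : Proc} (hP : NoInp 0 P) (hQ : NoInp 0 Q) :
    Cong (.nu (.par (.par P Q) S)) (.par (.nu (.par P S)) (.nu (.par Q S))) := by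
  obtain ⟨m, B, hB, h⟩ := hS
  exact (h.parR _).nu.trans
    ((Cong.dist hP hQ hB).trans ((h.symm.parR _).nu.par (h.symm.parR _).nu))

theorem push_rep (hS : IsServer S) {a : Name} {n : ℕ} {P P' S' : Proc} (hP : NoInp n P)
    (hP' : P.rename (rot n) = P') (hS' : (S.shift n).rename (rot n) = S') :
    Cong (.nu (.par (.rep (a + 1) n P) S)) (.rep a n (.nu (.par P' S'))) := by
  subst hP' hS'
  obtain ⟨m, B, hB, h⟩ := hS
  exact (h.parR _).nu.trans ((Cong.push_rep a n hP hB).trans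
    (.rep _ _ (((h.symm.shift n).rename (rot_injective n)).parR _).nu))

/-- A message to a server may be given its own copy of the server. -/
theorem push_out_self (hS : IsServer S) {n : ℕ} {P P' S' : Proc} (hP : NoInp n P)
    (hP' : P.rename (rot n) = P') (hS' : (S.shift n).rename (rot n) = S') :
    Cong (.nu (.par (.out 0 n P) S))
      (.nu (.par (.out 0 n ((Proc.nu (.par P' S')).rename (liftN n Nat.succ))) S)) := by
  subst hP' hS'
  obtain ⟨m, B, hB, h⟩ := hS
  refine (h.parR _).nu.trans ((Cong.push_out_self n hP hB).trans
    (Cong.par (.out _ _ (.rename (liftN_injective _ Nat.succ_injective) ?_)) h.symm).nu)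
  exact (((h.symm.shift n).rename (rot_injective n)).parR _).nu

end IsServer

/-- The server at the name `0` that forwards to the value `V`. -/
def server : Term → Env → Proc
  | .var x, ρ => .link .val 0 (ρ x + 1)
  | V, ρ => .nu (.par (.link .val 1 0) (optEncVal V (ρ.up 2) 0))

theorem server_rename (V : Term) (ρ : Env) (f : Name → Name) :
    (server V ρ).rename (liftN 1 f) = server V (f ∘ ρ) := by
  cases V <;> simp only [server, Proc.rename, optEncVal_rename, liftN_one_liftN,
    Env.liftN_comp_up] <;> rfl

theorem server_shift_rot (V : Term) (ρ : Env) (n : ℕ) :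
    ((server V ρ).shift n).rename (rot n) = server V (ρ.up n) := by
  rw [shift_rename_rot, server_rename]
  rfl

/-- A value forwarder unfolds to a replicated input. For an abstraction, the replication law moves
the restricted target of the forwarder below that input. -/
theorem isServer_server {V : Term} (hV : V.isValue) (ρ : Env) : IsServer (server V ρ) := by
  cases V with
  | var x => exact ⟨2, _, by simp [NoInp], Cong.link _ _ _⟩
  | lam M =>
    refine ⟨2, _, ?_, ((Cong.link _ _ _).parL _).nu.trans
      (Cong.push_rep' (B := optEnc M (ρ.up 2).bind 1) (by simp [NoInp]) (noInp_optEnc _ _ _ _)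
        rfl rfl)⟩
    simp only [shift, Proc.rename, optEnc_rename, NoInp]
    exact ⟨⟨by simp [liftN], by simp [liftN]⟩, by simp [rot], noInp_optEnc _ _ _ _⟩
  | app M N => simp [Term.isValue] at hV

/-! ## Forwarders composed with encodings -/

/-- `ν w (y ▷ w | ⟦V⟧ᵥ w)` expands `⟦V⟧ᵥ y`. -/
def Forwards (V : Term) : Prop :=
  ∀ (ρ : Env) (y : Name), Expands
    (.nu (.par (.link .val (y + 1) 0) (optEncVal V (ρ.up 1) 0))) (optEncVal V ρ y)

/-- `ν q (⟦M⟧q | q ▷ p)` expands `⟦M⟧p`. -/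
def Continues (M : Term) : Prop :=
  ∀ (ρ : Env) (p : Name), Expands
    (.nu (.par (optEnc M (ρ.up 1) 0) (.link .cont 0 (p + 1)))) (optEnc M ρ p)

theorem forwards_var (x : ℕ) : Forwards (.var x) := fun ρ y => Expands.link_trans .val y (ρ x)

/-- An encoded value is inert, so it moves below the output; there it faces `w' ▷ w`, which `hF`
absorbs. -/
theorem Forwards.send {V : Term} (hF : Forwards V) (ρ : Env) (y p : Name) :
    Expands (.nu (.par (optEncVal V (ρ.up 1) 0) (sendTo (y + 1) 0 (p + 1))))
      (.out y 2 (.par (optEncVal V (ρ.up 2) 0) (.link .cont 1 (p + 2)))) := by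
  refine ((Cong.par_comm _ _).nu.trans (Cong.push_out' (inert_optEncVal V _)
    (P' := .par (.link .val 1 0) (.link .cont 2 (p + 3)))
    (Q' := optEncVal V (ρ.up 3) 0) rfl ?_)).trans_expands (.out _ _ ?_)
  · simp only [shift, optEncVal_rename]; rfl
  · refine ((Cong.par_right_comm _ _ _).nu.trans
      (Cong.nu_par_left (Q := .link .cont 1 (p + 2)) rfl)).trans_expands (.parL _ (hF (ρ.up 2) 0))

/-- The call leaves two continuation forwarders in a chain, which collapse to the single one in
`sendTo`. -/
theorem call_link_val_value (V : Term) (ρ : Env) (y p : Name) :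
    Expands
      (.nu (.par (.out 0 2 (.par (optEncVal V (ρ.up 3) 0) (.link .cont 1 (p + 3))))
        (.link .val 0 (y + 1))))
      (.nu (.par (optEncVal V (ρ.up 1) 0) (sendTo (y + 1) 0 (p + 1)))) := by
  have := Expands.call_link_val (optEncVal V (ρ.up 1) 0) y p
  rw [optEncVal_rename] at this
  exact this.trans (.nu (.parR _ (.out _ _ (.parR _ (Expands.link_trans .cont 1 (p + 3))))))

/-- The general shape of the encoding of an application of values. -/
theorem app_values {V V' : Term} (hV : V.isValue) (hV' : V'.isValue) (hF : Forwards V')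
    (ρ : Env) (p : Name) :
    Expands (.nu (.par (optEncVal V (ρ.up 1) 0)
        (.nu (.par (optEncVal V' (ρ.up 2) 0) (sendTo 1 0 (p + 2))))))
      (optEnc (.app V V') ρ p) := by
  have key : Cong (.nu (.par (optEncVal V (ρ.up 1) 0)
        (.nu (.par (optEncVal V' (ρ.up 2) 0) (sendTo 1 0 (p + 2))))))
      (.nu (.nu (.par (optEncVal V (ρ.up 2) 1)
        (.par (optEncVal V' (ρ.up 2) 0) (sendTo 1 0 (p + 2)))))) := by
    refine ((Cong.par_nu _ _).trans (.of_eq ?_)).nu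
    simp only [shift, optEncVal_rename]; rfl
  cases V with
  | var x =>
    rw [optEnc_var_value x hV']
    refine (key.trans (Cong.trans ?_ ((Cong.nu_swap'
      (P := .par (.par (sendTo 1 0 (p + 2)) (.link .val 1 (ρ x + 2))) (optEncVal V' (ρ.up 2) 0))
      (Q := .par (.par (sendTo 0 1 (p + 2)) (.link .val 0 (ρ x + 2))) (optEncVal V' (ρ.up 2) 1))
      ?_).trans
      (Cong.nu_par_left (Q := optEncVal V' (ρ.up 1) 0) ?_).nu))).trans_expands ?_
    · exact (((Cong.par_comm _ _).parR _).trans ((Cong.par_assoc _ _ _).symm.trans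
        ((Cong.par_comm _ _).parL _))).nu.nu
    · simp only [Proc.rename, optEncVal_rename]; rfl
    · simp only [shift, optEncVal_rename]; rfl
    refine Expands.trans (.nu (.parL _ ?_)) ((Cong.par_comm _ _).nu.trans_expands
      (hF.send ρ (ρ x) p))
    -- The forwarder `w' ▷ w` in the message is itself the encoding of a variable named `w`, so the
    -- lemmas on values apply to it; the constant environment supplies that name.
    exact (call_link_val_value (.var 0) (fun _ => 0) (ρ x + 1) (p + 1)).trans
      ((forwards_var 0).send (fun _ => 0) (ρ x + 1) (p + 1))
  | lam L =>
    rw [optEnc_lam_value L hV']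
    exact .of_cong key
  | app M N => simp [Term.isValue] at hV

/-- Below the output the continuation forwarders form a chain, which collapses. -/
theorem sendTo_continues (y w p : Name) :
    Expands (.nu (.par (sendTo (y + 1) (w + 1) 0) (.link .cont 0 (p + 1)))) (sendTo y w p) := by
  refine (Cong.push_out' (.link _ _) rfl rfl).trans_expands (.out _ _ ?_)
  exact ((Cong.par_assoc _ _ _).nu.trans (Cong.nu_par_right (Q := .link .val 0 (w + 2)) rfl)).trans_expands
    (.parR _ (Expands.link_trans .cont 1 (p + 2)))

/-- No induction is needed: for an application the continuation name occurs only as the target of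
one forwarder. The new forwarder is moved there by scope extrusion and pushing below prefixes, and
the chain collapses. For a value, the output to the forwarder leaves a value forwarder, absorbed by
`hF`. -/
theorem continues_of_forwards {M : Term} (hF : M.isValue → Forwards M) : Continues M := by
  intro ρ p
  cases hM : M.isValue with
  | true =>
    rw [optEnc_value hM, optEnc_value hM]
    have := Expands.call_link_cont (inert_optEncVal M (ρ.up 1)) p
    rw [optEncVal_rename] at this
    exact this.trans (.out _ _ (hF hM (ρ.up 1) 0))
  | false =>
    obtain _ | _ | ⟨M, N⟩ := M
    · simp [Term.isValue] at hM
    · simp [Term.isValue] at hM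
    refine Term.app_cases ?_ ?_ ?_ ?_ ?_ M N
    · intro x V hV
      rw [optEnc_var_value x hV, optEnc_var_value x hV]
      refine (Cong.push_out' (P' := .par (optEncVal V (ρ.up 3) 1) (.link .cont 2 0))
        (.link _ _) ?_ rfl).trans_expands (.out _ _ ?_)
      · simp only [Proc.rename, optEncVal_rename]; rfl
      refine ((Cong.par_assoc _ _ _).nu.trans
        (Cong.nu_par_right (Q := optEncVal V (ρ.up 2) 0) ?_)).trans_expands
        (.parR _ (Expands.link_trans .cont 1 (p + 2)))
      simp only [shift, optEncVal_rename]; rfl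
    · intro L V hV
      rw [optEnc_lam_value L hV, optEnc_lam_value L hV]
      refine (Cong.push_nu rfl rfl).trans_expands (.nu ?_)
      refine (Cong.push_nu rfl rfl).trans_expands (.nu ?_)
      refine ((Cong.par_assoc _ _ _).nu.trans
        (Cong.nu_par_right (Q := optEncVal (.lam L) (ρ.up 2) 1) ?_)).trans_expands (.parR _ ?_)
      · simp only [shift, optEncVal_rename]; rfl
      refine ((Cong.par_assoc _ _ _).nu.trans
        (Cong.nu_par_right (Q := optEncVal V (ρ.up 2) 0) ?_)).trans_expands (.parR _ ?_)
      · simp only [shift, optEncVal_rename]; rfl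
      exact sendTo_continues 1 0 (p + 2)
    · intro V N hV hN
      rw [optEnc_value_app hV hN, optEnc_value_app hV hN]
      refine (Cong.push_nu rfl rfl).trans_expands (.nu ?_)
      refine ((Cong.par_assoc _ _ _).nu.trans
        (Cong.nu_par_right (Q := optEncVal V (ρ.up 1) 0) ?_)).trans_expands (.parR _ ?_)
      · simp only [shift, optEncVal_rename]; rfl
      refine (Cong.push_nu rfl rfl).trans_expands (.nu ?_)
      refine ((Cong.par_assoc _ _ _).nu.trans
        (Cong.nu_par_right (Q := optEnc N (ρ.up 2) 0) ?_)).trans_expands (.parR _ ?_)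
      · simp only [shift, optEnc_rename]; rfl
      exact (Cong.push_inp' (.link _ _) rfl rfl).trans_expands
        (.inp _ _ (sendTo_continues 2 0 (p + 3)))
    · intro M V hM hV
      rw [optEnc_app_value hM hV, optEnc_app_value hM hV]
      refine (Cong.push_nu rfl rfl).trans_expands (.nu ?_)
      refine ((Cong.par_assoc _ _ _).nu.trans
        (Cong.nu_par_right (Q := optEnc M (ρ.up 1) 0) ?_)).trans_expands (.parR _ ?_)
      · simp only [shift, optEnc_rename]; rfl
      refine (Cong.push_inp' (.link _ _) rfl rfl).trans_expands (.inp _ _ ?_)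
      refine (Cong.push_nu rfl rfl).trans_expands (.nu ?_)
      refine ((Cong.par_assoc _ _ _).nu.trans
        (Cong.nu_par_right (Q := optEncVal V (ρ.up 3) 0) ?_)).trans_expands (.parR _ ?_)
      · simp only [shift, optEncVal_rename]; rfl
      exact sendTo_continues 1 0 (p + 3)
    · intro M N hM hN
      rw [optEnc_app_app hM hN, optEnc_app_app hM hN]
      refine (Cong.push_nu rfl rfl).trans_expands (.nu ?_)
      refine ((Cong.par_assoc _ _ _).nu.trans
        (Cong.nu_par_right (Q := optEnc M (ρ.up 1) 0) ?_)).trans_expands (.parR _ ?_)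
      · simp only [shift, optEnc_rename]; rfl
      refine (Cong.push_inp' (.link _ _) rfl rfl).trans_expands (.inp _ _ ?_)
      refine (Cong.push_nu rfl rfl).trans_expands (.nu ?_)
      refine ((Cong.par_assoc _ _ _).nu.trans
        (Cong.nu_par_right (Q := optEnc N (ρ.up 3) 0) ?_)).trans_expands (.parR _ ?_)
      · simp only [shift, optEnc_rename]; rfl
      exact (Cong.push_inp' (.link _ _) rfl rfl).trans_expands
        (.inp _ _ (sendTo_continues 2 0 (p + 4)))

end CbvPiI

/-! ### Substitution by servers, and forwarding to abstractions. -/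

namespace CbvPiI

open Proc

/-! ## Pushing a server through a process -/

theorem rot_comp_liftN_rot (k n : ℕ) : rot k ∘ liftN k (rot n) = rot (n + k) := by
  funext i
  obtain h | ⟨j, rfl⟩ : i < k ∨ ∃ j, i = j + k := by
    by_cases h : i < k
    · exact .inl h
    · exact .inr ⟨i - k, by grind⟩
  · simp only [rot, liftN, Function.comp]; grind
  · have h : liftN k (rot n) (j + k) = rot n j + k := by simp [liftN]
    simp only [Function.comp, h, rot]
    grind

/-- The server for `V`, restricted, can be pushed into `P`, which is below `n` binders, so as to
yield `P'`. The name of the server is `n` in `P`. -/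
def Pushes (V : Term) (ρ : Env) (n : ℕ) (P P' : Proc) : Prop :=
  Expands (.nu (.par (P.rename (rot n)) (server V (ρ.up n)))) P'

namespace Pushes

variable {V : Term} {ρ : Env} {n : ℕ} {P P' Q Q' : Proc}

theorem zero : Pushes V ρ 0 P P' ↔ Expands (.nu (.par P (server V ρ))) P' := by
  rw [Pushes, rename_rot_zero]; rfl

theorem nu (h : Pushes V ρ (n + 1) P P') : Pushes V ρ n (.nu P) (.nu P') := by
  refine (Cong.push_nu ?_ (server_shift_rot _ _ _)).trans_expands (Expands.nu h)
  rw [Proc.rename_rename, rot_comp_liftN_rot]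

/-- This is where the server is duplicated, one copy per component. -/
theorem par (hV : V.isValue) (hP : NoInp n P) (hQ : NoInp n Q) (h : Pushes V ρ n P P')
    (h' : Pushes V ρ n Q Q') : Pushes V ρ n (.par P Q) (.par P' Q') :=
  ((isServer_server hV _).dist hP.rename_rot hQ.rename_rot).trans_expands (Expands.par h h')

theorem inp (hV : V.isValue) {a b : Name} {k : ℕ} (ha : rot n a = b + 1)
    (h : Pushes V ρ (n + k) P P') : Pushes V ρ n (.inp a k P) (.inp b k P') := by
  rw [Pushes, Proc.rename, ha]
  refine (Cong.push_inp' (P' := P.rename (rot (n + k)))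
    (isServer_server hV _).inert ?_ (server_shift_rot _ _ _)).trans_expands (.inp _ _ ?_)
  · rw [Proc.rename_rename, rot_comp_liftN_rot]
  · rw [Pushes] at h
    rwa [show (ρ.up n).up k = ρ.up (n + k) from funext fun i => Nat.add_assoc _ _ _]

theorem out (hV : V.isValue) {a b : Name} {k : ℕ} (ha : rot n a = b + 1)
    (h : Pushes V ρ (n + k) P P') : Pushes V ρ n (.out a k P) (.out b k P') := by
  rw [Pushes, Proc.rename, ha]
  refine (Cong.push_out' (P' := P.rename (rot (n + k)))
    (isServer_server hV _).inert ?_ (server_shift_rot _ _ _)).trans_expands (.out _ _ ?_)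
  · rw [Proc.rename_rename, rot_comp_liftN_rot]
  · rw [Pushes] at h
    rwa [show (ρ.up n).up k = ρ.up (n + k) from funext fun i => Nat.add_assoc _ _ _]

theorem rep (hV : V.isValue) {a b : Name} {k : ℕ} (hP : NoInp (n + k) P) (ha : rot n a = b + 1)
    (h : Pushes V ρ (n + k) P P') : Pushes V ρ n (.rep a k P) (.rep b k P') := by
  rw [Pushes, Proc.rename, ha]
  refine ((isServer_server hV _).push_rep (P' := P.rename (rot (n + k))) ?_ ?_
    (server_shift_rot _ _ _)).trans_expands (.rep _ _ ?_)
  · refine hP.rename fun i e => ?_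
    exact liftN_eq_add (l := 0) (fun i => rot_eq_zero_iff.1) (by rwa [Nat.zero_add])
  · rw [Proc.rename_rename, rot_comp_liftN_rot]
  · rw [Pushes] at h
    rwa [show (ρ.up n).up k = ρ.up (n + k) from funext fun i => Nat.add_assoc _ _ _]

theorem gc (hV : V.isValue) (h : P.rename (rot n) = P'.shift 1) : Pushes V ρ n P P' :=
  .of_cong (Cong.nu_gc (isServer_server hV _).inert h)

theorem link (hV : V.isValue) {k : Link} {a a' b b' : Name} (ha : rot n a = a' + 1)
    (hb : rot n b = b' + 1) : Pushes V ρ n (.link k a b) (.link k a' b') :=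
  gc hV (by simp only [Proc.rename, shift, ha, hb])

theorem sendTo (hV : V.isValue) {y y' w w' p p' : Name} (hy : rot n y = y' + 1)
    (hw : rot n w = w' + 1) (hp : rot n p = p' + 1) :
    Pushes V ρ n (sendTo y w p) (sendTo y' w' p') :=
  gc hV (by simp [CbvPiI.sendTo, Proc.rename, shift, liftN, hy, hw, hp])

end Pushes

/-! ## Substitution of values -/

/-- `σ` substitutes `V`, with its variables named by `ρV`, for the variables that `ρ` names `0`,
and renames the other ones. The variables in the image of `σ` are named by `ρ'`. -/
def Instantiates (V : Term) (ρV : Env) (σ : ℕ → Term) (ρ ρ' : Env) : Prop :=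
  ∀ i, (ρ i = 0 ∧ ∃ f, σ i = V.rename f ∧ ρ' ∘ f = ρV) ∨ ∃ j, σ i = .var j ∧ ρ i = ρ' j + 1

namespace Instantiates

variable {V : Term} {ρV : Env} {σ : ℕ → Term} {ρ ρ' : Env}

theorem up (h : Instantiates V ρV σ ρ ρ') (n : ℕ) :
    Instantiates V (ρV.up n) σ (rot n ∘ ρ.up n) (ρ'.up n) := by
  intro i
  obtain ⟨h0, f, hf, rfl⟩ | ⟨j, hj, h1⟩ := h i
  · exact .inl ⟨by simp [Env.up, h0, rot], f, hf, rfl⟩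
  · refine .inr ⟨j, hj, ?_⟩
    simp only [Env.up, h1, rot, Function.comp]
    grind

theorem bind (h : Instantiates V ρV σ ρ ρ') :
    Instantiates V (ρV.up 2) (Term.ups σ) (rot 2 ∘ ρ.bind) ρ'.bind := by
  intro i
  cases i with
  | zero => exact .inr ⟨0, rfl, rfl⟩
  | succ i =>
    obtain ⟨h0, f, hf, rfl⟩ | ⟨j, hj, h1⟩ := h i
    · refine .inl ⟨by simp [Env.bind, h0, rot], Nat.succ ∘ f, ?_, rfl⟩
      rw [Term.ups, hf, Term.rename_rename]
    · refine .inr ⟨j + 1, by rw [Term.ups, hj]; rfl, ?_⟩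
      simp [Env.bind, h1, rot]

theorem isValue_subst (h : Instantiates V ρV σ ρ ρ') (hV : V.isValue) (M : Term) :
    (M.subst σ).isValue = M.isValue := by
  cases M with
  | var x =>
    obtain ⟨-, f, hf, -⟩ | ⟨j, hj, -⟩ := h x
    · rw [Term.subst, hf, Term.isValue_rename, hV]; rfl
    · rw [Term.subst, hj]; rfl
  | lam M => rfl
  | app M N => rfl

theorem size_subst (h : Instantiates V ρV σ ρ ρ') {x : ℕ} (hV : V = .var x) (M : Term) :
    (M.subst σ).size = M.size := by
  refine M.size_subst fun i => ?_
  obtain ⟨-, f, hf, -⟩ | ⟨j, hj, -⟩ := h i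
  · rw [hf, hV]; rfl
  · rw [hj]; rfl

end Instantiates

/-- The server for `V` substitutes `V` in the encoding of `M`. -/
def Substitutes (V M : Term) : Prop :=
  ∀ (ρV : Env) (σ : ℕ → Term) (ρ ρ' : Env), Instantiates V ρV σ ρ ρ' →
    (∀ p, Expands (.nu (.par (optEnc M ρ (p + 1)) (server V ρV))) (optEnc (M.subst σ) ρ' p)) ∧
    (M.isValue → ∀ y, Expands (.nu (.par (optEncVal M ρ (y + 1)) (server V ρV)))
      (optEncVal (M.subst σ) ρ' y))

namespace Substitutes

variable {V M : Term} {ρV : Env} {σ : ℕ → Term} {ρ ρ' : Env}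

theorem term (h : Substitutes V M) (hi : Instantiates V ρV σ ρ ρ') {n : ℕ} {q q' : Name}
    (hq : rot n q = q' + 1) :
    Pushes V ρV n (optEnc M (ρ.up n) q) (optEnc (M.subst σ) (ρ'.up n) q') := by
  rw [Pushes, optEnc_rename, hq]
  exact (h _ _ _ _ (hi.up n)).1 q'

theorem value (h : Substitutes V M) (hM : M.isValue) (hi : Instantiates V ρV σ ρ ρ') {n : ℕ}
    {y y' : Name} (hy : rot n y = y' + 1) :
    Pushes V ρV n (optEncVal M (ρ.up n) y) (optEncVal (M.subst σ) (ρ'.up n) y') := by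
  rw [Pushes, optEncVal_rename, hy]
  exact (h _ _ _ _ (hi.up n)).2 hM y'

/-- For values, the second clause suffices. -/
theorem of_value (hV : V.isValue) (hM : M.isValue)
    (h : ∀ (ρV : Env) (σ : ℕ → Term) (ρ ρ' : Env), Instantiates V ρV σ ρ ρ' →
      ∀ y, Expands (.nu (.par (optEncVal M ρ (y + 1)) (server V ρV)))
        (optEncVal (M.subst σ) ρ' y)) : Substitutes V M := by
  refine fun ρV σ ρ ρ' hi => ⟨fun p => ?_, fun _ => h _ _ _ _ hi⟩
  have hMσ : (M.subst σ).isValue := by rw [hi.isValue_subst hV, hM]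
  rw [optEnc_value hM, optEnc_value hMσ, ← Pushes.zero]
  refine Pushes.out hV rfl ?_
  rw [Pushes, optEncVal_rename]
  exact h _ _ _ _ (hi.up 1) 0

theorem lam (hV : V.isValue) (h : Substitutes V M) : Substitutes V (.lam M) := by
  refine of_value hV rfl fun ρV σ ρ ρ' hi y => ?_
  rw [Term.subst, optEncVal_lam, optEncVal_lam, ← Pushes.zero]
  refine Pushes.rep hV (noInp_optEnc _ _ _ _) rfl ?_
  rw [Pushes, optEnc_rename]
  exact (h _ _ _ _ hi.bind).1 1

end Substitutes

/-- The two forwarders in a row collapse first; for a variable nothing else remains. Asking `hF`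
only of other values keeps the size bound in `substitutes` out of this case. -/
theorem server_forwards {V : Term} (hF : (∀ x, V ≠ .var x) → Forwards V) (ρ : Env) (y : Name) :
    Expands (.nu (.par (.link .val (y + 1) 0) (server V ρ))) (optEncVal V ρ y) := by
  have key (hF : Forwards V) : Expands (.nu (.par (.link .val (y + 1) 0)
      (.nu (.par (.link .val 1 0) (optEncVal V (ρ.up 2) 0))))) (optEncVal V ρ y) := by
    refine ((Cong.par_nu _ _).trans (Cong.par_assoc _ _ _).symm.nu).nu.trans_expands ?_
    refine (Cong.nu_swap' (Q := .par (.par (.link .val (y + 2) 0) (.link .val 0 1))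
      (optEncVal V (ρ.up 2) 1)) ?_).trans_expands ?_
    · simp only [shift, Proc.rename, optEncVal_rename]; rfl
    refine (Cong.nu_par_left (Q := optEncVal V (ρ.up 1) 0) ?_).nu.trans_expands ?_
    · simp only [shift, optEncVal_rename]; rfl
    exact (Expands.parL _ (Expands.link_trans .val (y + 1) 0)).nu.trans (hF ρ y)
  cases V with
  | var x => exact Expands.link_trans .val y (ρ x)
  | lam M => exact key (hF (by simp))
  | app M N => exact key (hF (by simp))

/-- For a variable, `hF.send` turns the forwarded call into the clause for a variable applied to a
value. For an abstraction, the forwarded call next to `⟦V⟧ᵥ` has the general shape treated by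
`app_values`. -/
theorem server_call_value {V U : Term} (hV : V.isValue) (hU : U.isValue) (hF : Forwards U)
    (ρ : Env) (f : ℕ → ℕ) (p : Name) :
    Expands (.nu (.par (.out 0 2 (.par (optEncVal U (ρ.up 3) 0) (.link .cont 1 (p + 3))))
      (server V (ρ ∘ f)))) (optEnc (.app (V.rename f) U) ρ p) := by
  cases hVl : V with
  | var x =>
    rw [Term.rename, optEnc_var_value _ hU]
    exact (call_link_val_value U ρ (ρ (f x)) p).trans (hF.send ρ (ρ (f x)) p)
  | lam M =>
    rw [← hVl]
    have hs : server V (ρ ∘ f) =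
        .nu (.par (.link .val 1 0) (optEncVal V (Env.up (ρ ∘ f) 2) 0)) := by rw [hVl]; rfl
    rw [hs]
    refine ((Cong.par_nu _ _).trans (Cong.par_assoc _ _ _).symm.nu).nu.trans_expands ?_
    refine (Cong.nu_swap' (Q := .par (.par (.out 0 2 (.par (optEncVal U (ρ.up 4) 0)
      (.link .cont 1 (p + 4)))) (.link .val 0 1)) (optEncVal V (Env.up (ρ ∘ f) 2) 1)) ?_).trans_expands ?_
    · simp only [shift, Proc.rename, optEncVal_rename]; rfl
    refine (Cong.nu_par_left (Q := optEncVal V (Env.up (ρ ∘ f) 1) 0) ?_).nu.trans_expands ?_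
    · simp only [shift, optEncVal_rename]; rfl
    refine Expands.trans (.nu (.parL _ (call_link_val_value U (ρ.up 1) 0 (p + 1)))) ?_
    have := app_values (V := V.rename f) (by rwa [Term.isValue_rename]) hU hF ρ p
    rw [optEncVal_term_rename] at this
    exact (Cong.par_comm _ _).nu.trans_expands this
  | app M N => rw [hVl] at hV; simp [Term.isValue] at hV

/-- The argument `W` may mention the server that is being called. The message therefore first
receives a private copy, which turns `W` into `U`; the other copy answers the call. -/
theorem server_call {V U W : Term} (hV : V.isValue) (hU : U.isValue)
    (hF : Forwards U) {ρ ρ' : Env} {f : ℕ → ℕ}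
    (h : Pushes V (ρ' ∘ f) 2 (optEncVal W (ρ.up 2) 0) (optEncVal U (ρ'.up 2) 0)) (p : Name) :
    Expands (.nu (.par (.out 0 2 (.par (optEncVal W (ρ.up 2) 0) (.link .cont 1 (p + 3))))
      (server V (ρ' ∘ f)))) (optEnc (.app (V.rename f) U) ρ' p) := by
  have hP : NoInp 2 (.par (optEncVal W (ρ.up 2) 0) (.link .cont 1 (p + 3))) :=
    ⟨noInp_optEncVal _ _ (by simp), by simp [NoInp]⟩
  refine ((isServer_server hV _).push_out_self hP rfl (server_shift_rot _ _ _)).trans_expands ?_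
  have h2 : Pushes V (ρ' ∘ f) 2 (.par (optEncVal W (ρ.up 2) 0) (.link .cont 1 (p + 3)))
      (.par (optEncVal U (ρ'.up 2) 0) (.link .cont 1 (p + 2))) :=
    .par hV hP.1 hP.2 h (.link hV rfl rfl)
  refine Expands.trans (.nu (.parL _ (.out _ _ (h2.rename
    (liftN_injective 2 Nat.succ_injective))))) ?_
  rw [Proc.rename, optEncVal_rename]
  exact server_call_value hV hU hF ρ' f p

/-- Structural induction on `M`: the server is pushed through all constructors, and only the
occurrences of the substituted variable do real work. The size bound in `hF` matters only when `V`
is a variable, so the lemma serves both inside the induction on size and afterwards for every value.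
-/
theorem substitutes {V : Term} (hV : V.isValue) {n : ℕ}
    (hF : ∀ U : Term, U.isValue → (∀ x, V = .var x → U.size < n) → Forwards U) (M : Term)
    (hn : M.size ≤ n) : Substitutes V M := by
  induction M with
  | var x =>
    refine .of_value hV rfl fun ρV σ ρ ρ' hi y => ?_
    rw [optEncVal_var, Term.subst]
    obtain ⟨h0, f, hf, rfl⟩ | ⟨j, hj, h1⟩ := hi x
    · rw [h0, hf, optEncVal_term_rename]
      exact server_forwards (fun h => hF V hV fun x hx => (h x hx).elim) _ y
    · rw [h1, hj, ← Pushes.zero]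
      exact .link hV rfl rfl
  | lam M ih => exact (ih (by simp only [Term.size] at hn; omega)).lam hV
  | app M N ihM ihN =>
    simp only [Term.size] at hn
    replace ihM := ihM (by omega)
    replace ihN := ihN (by omega)
    refine fun ρV σ ρ ρ' hi => ⟨fun p => ?_, by simp [Term.isValue]⟩
    -- If `V` is a variable, the substituted argument has the size of `N`, which is less than `n`.
    have hNF : N.isValue → Forwards (N.subst σ) := fun hN =>
      hF _ (by rw [hi.isValue_subst hV, hN]) fun x hx => by rw [hi.size_subst hx]; omega
    have hval := hi.isValue_subst hV
    have hs : ∀ M N : Term, (Term.app M N).subst σ = .app (M.subst σ) (N.subst σ) :=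
      fun _ _ => rfl
    rw [hs]
    clear hn hF
    revert ihM ihN hNF
    refine Term.app_cases ?_ ?_ ?_ ?_ ?_ M N
    · intro x W hW _ ih hNF
      have hWσ : (W.subst σ).isValue := by rw [hval, hW]
      rw [optEnc_var_value x hW, Term.subst]
      obtain ⟨h0, f, hf, rfl⟩ | ⟨j, hj, h1⟩ := hi x
      · rw [h0, hf]
        exact server_call hV hWσ (hNF hW) (ih.value hW hi rfl) p
      · rw [h1, hj, optEnc_var_value j hWσ, ← Pushes.zero]
        refine .out hV rfl (.par hV (noInp_optEncVal _ _ (by simp)) (by simp [NoInp])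
          (ih.value hW hi rfl) (.link hV rfl rfl))
    · intro L W hW ih' ih _
      have hWσ : (W.subst σ).isValue := by rw [hval, hW]
      rw [optEnc_lam_value L hW, Term.subst, optEnc_lam_value _ hWσ, ← Pushes.zero]
      refine .nu (.nu (.par hV (noInp_optEncVal _ _ (by simp))
        ⟨noInp_optEncVal _ _ (by simp), by simp [NoInp, sendTo]⟩ (ih'.value rfl hi rfl)
        (.par hV (noInp_optEncVal _ _ (by simp)) (by simp [NoInp, sendTo])
          (ih.value hW hi rfl) (.sendTo hV rfl rfl rfl))))
    · intro W N hW hN ih' ih _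
      rw [optEnc_value_app hW hN, optEnc_value_app (by rw [hval, hW]) (by rw [hval, hN]),
        ← Pushes.zero]
      exact .nu (.par hV (noInp_optEncVal _ _ (by simp))
        ⟨noInp_optEnc _ _ _ _, by simp [NoInp, sendTo]⟩ (ih'.value hW hi rfl)
        (.nu (.par hV (noInp_optEnc _ _ _ _) (by simp [NoInp, sendTo]) (ih.term hi rfl)
          (.inp hV rfl (.sendTo hV rfl rfl rfl)))))
    · intro M W hM hW ih' ih _
      rw [optEnc_app_value hM hW, optEnc_app_value (by rw [hval, hM]) (by rw [hval, hW]),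
        ← Pushes.zero]
      exact .nu (.par hV (noInp_optEnc _ _ _ _)
        ⟨by simp, noInp_optEncVal _ _ (by simp), by simp [NoInp, sendTo]⟩ (ih'.term hi rfl)
        (.inp hV rfl (.nu (.par hV (noInp_optEncVal _ _ (by simp)) (by simp [NoInp, sendTo])
          (ih.value hW hi rfl) (.sendTo hV rfl rfl rfl)))))
    · intro M N hM hN ih' ih _
      rw [optEnc_app_app hM hN, optEnc_app_app (by rw [hval, hM]) (by rw [hval, hN]),
        ← Pushes.zero]
      exact .nu (.par hV (noInp_optEnc _ _ _ _)
        ⟨by simp, noInp_optEnc _ _ _ _, by simp [NoInp, sendTo]⟩ (ih'.term hi rfl)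
        (.inp hV rfl (.nu (.par hV (noInp_optEnc _ _ _ _) (by simp [NoInp, sendTo])
          (ih.term hi rfl) (.inp hV rfl (.sendTo hV rfl rfl rfl))))))

/-! ## Forwarding to arbitrary values -/

/-- The names of the variables below an abstraction, when the continuation is not abstracted. -/
def Env.bindVar (ρ : Env) : Env
  | 0 => 0
  | i + 1 => ρ i + 1

/-- The body of an abstraction, called with forwarders to an argument and a continuation. -/
theorem Continues.body_call {M : Term} (hM : Continues M) (ρ : Env) (w p : Name) :
    Expands (.nu (.nu (.par (.par (.link .val 0 (w + 2)) (.link .cont 1 (p + 2)))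
        (optEnc M ρ.bind 1))))
      (.nu (.par (optEnc M ρ.bindVar (p + 1)) (.link .val 0 (w + 1)))) := by
  refine (Cong.nu_swap' (Q := .par (.par (.link .val 1 (w + 2)) (.link .cont 0 (p + 2)))
    (optEnc M (ρ.bindVar.up 1) 0)) ?_).trans_expands ?_
  · simp only [Proc.rename, optEnc_rename]
    congr 1
    refine congrArg₂ (optEnc M) (funext fun i => ?_) rfl
    cases i <;> rfl
  refine ((Cong.par_assoc _ _ _).nu.trans (Cong.nu_par_right
    (Q := .link .val 0 (w + 1)) rfl)).nu.trans_expands ?_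
  refine Expands.nu ((Cong.par_comm _ _).trans_expands (.parL _ ?_))
  exact (Cong.par_comm _ _).nu.trans_expands (hM ρ.bindVar (p + 1))

/-- The identity substitution, read as replacing the bound variable by itself under a new name: a
forwarder between the two names performs an alpha-conversion. -/
theorem instantiates_bindVar (ρ : Env) :
    Instantiates (.var 0) ρ.bind Term.var (Env.up ρ 2).bindVar ρ.bind := by
  intro i
  cases i with
  | zero => exact .inl ⟨rfl, id, rfl, rfl⟩
  | succ i => exact .inr ⟨i + 1, rfl, rfl⟩

/-- The abstraction is pushed below the forwarder's input, where it is called at once and becomes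
garbage. Its body is left with two forwarders: `hM` absorbs that of the continuation and `hS` that
of the argument. -/
theorem forwards_lam {M : Term} (hM : Continues M) (hS : Substitutes (.var 0) M) :
    Forwards (.lam M) := by
  intro ρ y
  rw [optEncVal_lam, optEncVal_lam]
  refine ((Cong.link _ _ _).parL _).nu.trans_expands ((Cong.push_rep' (by simp [NoInp])
    (noInp_optEnc _ _ _ _) (P' := .out 0 2 (.par (.link .val 0 3) (.link .cont 1 4)))
    (Q' := .rep 0 2 (optEnc M (Env.up ρ 3).bind 1)) rfl ?_).trans_expands (.rep _ _ ?_))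
  · simp only [shift, Proc.rename, optEnc_rename]
    refine congrArg _ (congrArg₂ (optEnc M) (funext fun i => ?_) rfl)
    cases i <;> rfl
  refine (Expands.call_rep _ _ _).trans ((Cong.nu_gc (P' := .nu (.nu
    (.par (.par (.link .val 0 2) (.link .cont 1 3)) (optEnc M (Env.up ρ 2).bind 1))))
    (.rep _ _) ?_).trans_expands ?_)
  · simp only [nuN, shift, Proc.rename, optEnc_rename]
    refine congrArg (fun P => Proc.nu (.nu (.par _ P)))
      (congrArg₂ (optEnc M) (funext fun i => ?_) rfl)
    cases i <;> rfl
  refine (hM.body_call (ρ.up 2) 0 1).trans ?_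
  have := (hS _ _ _ _ (instantiates_bindVar ρ)).1 1
  rwa [Term.subst_var] at this

/-- Induction on size: the body of an abstraction, and its arguments after replacement of variables
by variables, are smaller than the abstraction. -/
theorem forwards_of_isValue {V : Term} (hV : V.isValue) : Forwards V := by
  suffices ∀ n, ∀ V : Term, V.isValue → V.size < n → Forwards V from
    this _ V hV (Nat.lt_succ_self _)
  intro n
  induction n with
  | zero => intro V _ h; omega
  | succ n ih =>
    intro V hV h
    cases V with
    | var x => exact forwards_var x
    | lam M =>
      have hn : M.size < n := by simp only [Term.size] at h; omega
      exact forwards_lam (continues_of_forwards fun hM => ih M hM hn)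
        (substitutes rfl (fun U hU hs => ih U hU (hs 0 rfl)) M hn.le)
    | app M N => simp [Term.isValue] at hV

theorem continues (M : Term) : Continues M := continues_of_forwards forwards_of_isValue

theorem substitutes_value {V : Term} (hV : V.isValue) (M : Term) : Substitutes V M :=
  substitutes hV (fun _ hU _ => forwards_of_isValue hU) M le_rfl

end CbvPiI

/-! ### Reduction of a redex and closure under evaluation contexts. -/

namespace CbvPiI

open Proc

/-! ## Evaluation contexts -/

/-- The left side is the clause for a non-value argument, but `N` is a reduct and may be a value,
whose application has another clause. -/
theorem Expands.appR_context {V N : Term} (hV : V.isValue) {P : Proc} (ρ : Env) (p : Name)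
    (h : Expands P (optEnc N (ρ.up 2) 0)) :
    Expands (.nu (.par (optEncVal V (ρ.up 1) 0) (.nu (.par P (.inp 0 1 (sendTo 2 0 (p + 3)))))))
      (optEnc (.app V N) ρ p) := by
  cases hN : N.isValue with
  | false =>
    rw [optEnc_value_app hV hN]
    exact .nu (.parR _ (.nu (.parL _ h)))
  | true =>
    rw [optEnc_value hN] at h
    -- The value is sent at the restricted `r`; that communication is an expansion and leaves the
    -- general shape of an application of values.
    refine Expands.trans (.nu (.parR _ ?_)) (app_values hV hN (forwards_of_isValue hN) ρ p)
    refine (h.parL _).nu.trans ((Expands.call_inp _ _ _).trans_cong ?_)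
    refine (Cong.nu_swap' (Q := Proc.shift 1 (.par (optEncVal N (ρ.up 2) 0)
      (sendTo 1 0 (p + 2)))) ?_).trans (Cong.nu (Cong.nu_unused rfl))
    simp only [shift, Proc.rename, optEncVal_rename]; rfl

theorem Expands.appL_value_context {M V : Term} (hV : V.isValue) {P : Proc} (ρ : Env) (p : Name)
    (h : Expands P (optEnc M (ρ.up 1) 0)) :
    Expands (.nu (.par P
        (.inp 0 1 (.nu (.par (optEncVal V (ρ.up 3) 0) (sendTo 1 0 (p + 3)))))))
      (optEnc (.app M V) ρ p) := by
  cases hM : M.isValue with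
  | false =>
    rw [optEnc_app_value hM hV]
    exact .nu (.parL _ h)
  | true =>
    rw [optEnc_value hM] at h
    refine Expands.trans ?_ (app_values hM hV (forwards_of_isValue hV) ρ p)
    refine (h.parL _).nu.trans ((Expands.call_inp _ _ _).trans_cong ?_)
    refine (Cong.nu_swap' (Q := Proc.shift 1 (.par (optEncVal M (ρ.up 1) 0)
      (.nu (.par (optEncVal V (ρ.up 2) 0) (sendTo 1 0 (p + 2)))))) ?_).trans
      (Cong.nu (Cong.nu_unused rfl))
    simp only [shift, Proc.rename, optEncVal_rename]; rfl

/-- If `M` is a value, the communication yields exactly the clause for a value applied to a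
non-value, so `app_values` is not needed. -/
theorem Expands.appL_context {M N : Term} (hN : N.isValue = false) {P : Proc} (ρ : Env)
    (p : Name) (h : Expands P (optEnc M (ρ.up 1) 0)) :
    Expands (.nu (.par P
        (.inp 0 1 (.nu (.par (optEnc N (ρ.up 3) 0) (.inp 0 1 (sendTo 2 0 (p + 4))))))))
      (optEnc (.app M N) ρ p) := by
  cases hM : M.isValue with
  | false =>
    rw [optEnc_app_app hM hN]
    exact .nu (.parL _ h)
  | true =>
    rw [optEnc_value hM] at h
    rw [optEnc_value_app hM hN]
    refine (h.parL _).nu.trans ((Expands.call_inp _ _ _).trans_cong ?_)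
    refine (Cong.nu_swap' (Q := Proc.shift 1 (.par (optEncVal M (ρ.up 1) 0)
      (.nu (.par (optEnc N (ρ.up 2) 0) (.inp 0 1 (sendTo 2 0 (p + 3))))))) ?_).trans
      (Cong.nu (Cong.nu_unused rfl))
    simp only [shift, Proc.rename, optEncVal_rename, optEnc_rename]; rfl

/-! ## The reduction of a redex -/

theorem instantiates_inst (V : Term) (ρ : Env) :
    Instantiates V ρ (fun i => match i with | 0 => V | j + 1 => .var j) ρ.bindVar ρ := by
  intro i
  cases i with
  | zero => exact .inl ⟨rfl, id, (Term.rename_id V).symm, rfl⟩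
  | succ i => exact .inr ⟨i, rfl, rfl⟩

/-- Exchanging the two restrictions puts the forwarder next to `⟦V⟧ᵥ`. Together they are the server
for an abstraction, and collapse to it when `V` is a variable; the server then substitutes. -/
theorem Expands.inst {M V : Term} (hV : V.isValue) (ρ : Env) (p : Name) :
    Expands (.nu (.par (optEncVal V (ρ.up 1) 0)
        (.nu (.par (optEnc M (ρ.up 1).bindVar (p + 2)) (.link .val 0 1)))))
      (optEnc (M.inst V) ρ p) := by
  refine Expands.trans ?_ ((substitutes_value hV M _ _ _ _ (instantiates_inst V ρ)).1 p)
  have key : Expands (.nu (.par (.link .val 1 0) (optEncVal V (ρ.up 2) 0))) (server V ρ) := by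
    cases V with
    | var x => exact Expands.link_trans .val 0 (ρ x + 1)
    | lam L => exact .refl _
    | app M N => exact .refl _
  refine Expands.trans (.of_cong ?_) (key.parR _).nu
  refine ((Cong.par_nu _ _).nu.trans ((Cong.nu_swap'
    (Q := .par (optEncVal V (ρ.up 2) 0)
      (.par ((optEnc M ρ.bindVar (p + 1)).shift 1) (.link .val 1 0))) ?_).trans (Cong.nu ?_)))
  · simp only [shift, Proc.rename, optEncVal_rename, optEnc_rename]
    refine congrArg (fun P => Proc.par _ (.par P _)) (congrArg₂ (optEnc M) (funext fun i => ?_) rfl)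
    cases i <;> rfl
  · exact ((Cong.par_left_comm _ _ _).trans ((Cong.par_comm _ _).parR _)).nu.trans
      (Cong.nu_par_right rfl)

theorem redex_cong (M : Term) {V : Term} (hV : V.isValue) (ρ : Env) (p : Name) :
    Cong (optEnc (.app (.lam M) V) ρ p)
      (.nu (.par (optEncVal V (ρ.up 1) 0)
        (.nu (.par (sendTo 0 1 (p + 2)) (.rep 0 2 (optEnc M (ρ.up 2).bind 1)))))) := by
  rw [optEnc_lam_value M hV, optEncVal_lam]
  refine ((Cong.par_left_comm _ _ _).trans ((Cong.par_comm _ _).parR _)).nu.nu.trans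
    ((Cong.nu_swap' (Q := .par (optEncVal V (ρ.up 2) 1)
      (.par (sendTo 0 1 (p + 2)) (.rep 0 2 (optEnc M (ρ.up 2).bind 1)))) ?_).trans
      (Cong.nu_par_right ?_).nu)
  · simp only [Proc.rename, optEncVal_rename, optEnc_rename]
    refine congrArg (fun P => Proc.par _ (.par _ (.rep _ _ P)))
      (congrArg₂ (optEnc M) (funext fun i => ?_) rfl)
    cases i <;> rfl
  · simp only [shift, optEncVal_rename]; rfl

/-- After the call nothing mentions the function's name, so its server is garbage; `body_call` then
removes the continuation forwarder. -/
theorem redex_call_expands (M : Term) {V : Term} (hV : V.isValue) (ρ : Env) (p : Name) :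
    Expands (.nu (.par (optEncVal V (ρ.up 1) 0) (.nu (.par
      (nuN 2 (.par (.par (.link .val 0 3) (.link .cont 1 (p + 4))) (optEnc M (ρ.up 2).bind 1)))
      (.rep 0 2 (optEnc M (ρ.up 2).bind 1)))))) (optEnc (M.inst V) ρ p) := by
  refine Expands.trans (.nu (.parR _ ?_)) (Expands.inst hV ρ p)
  refine (Cong.nu_gc (P' := .nu (.nu (.par (.par (.link .val 0 2) (.link .cont 1 (p + 3)))
    (optEnc M (ρ.up 1).bind 1)))) (.rep _ _) ?_).trans_expands
    ((continues M).body_call (ρ.up 1) 0 (p + 1))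
  simp only [nuN, shift, Proc.rename, optEnc_rename]
  refine congrArg (fun P => Proc.nu (.nu (.par _ P)))
    (congrArg₂ (optEnc M) (funext fun i => ?_) rfl)
  cases i <;> rfl

/-- `M` reduces to a process that expands the encoding of `N`, and itself expands it. -/
def StepValid (M N : Term) : Prop :=
  ∀ (ρ : Env) (p : Name), (∃ P, Trans (optEnc M ρ p) .tau P ∧ Expands P (optEnc N ρ p)) ∧
    Expands (optEnc M ρ p) (optEnc N ρ p)

theorem stepValid_redex (M : Term) {V : Term} (hV : V.isValue) :
    StepValid (.app (.lam M) V) (M.inst V) := by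
  intro ρ p
  have hc := redex_cong M hV ρ p
  have hD := redex_call_expands M hV ρ p
  constructor
  -- The step is taken in the rearranged process and carried back along `Cong`, which is a strong
  -- bisimulation and therefore yields exactly one `τ`.
  · obtain ⟨P, t, hP⟩ := hc.symm.matches _ _
      (.res_tau (.parR _ (.server_call (optEnc M (ρ.up 2).bind 1) (.out 0 2 _))))
    refine ⟨P, t, hP.symm.trans_expands ((Cong.nu ?_).trans_expands hD)⟩
    rw [Act.bn, shift_zero]
    exact (Cong.server_call _ _ _).parR _
  -- The restricted call is deterministic, hence itself an expansion.
  · exact hc.trans_expands (((Expands.call_rep _ _ _).parR _).nu.trans hD)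

/-- This fixes the clause of the encoding on the source side of a reduction; only the target can
change clause. -/
theorem EvCtx.isValue_fill_app (E : EvCtx) (M N : Term) : (E.fill (.app M N)).isValue = false := by
  cases E <;> rfl

theorem StepValid.appR {V M N : Term} (hV : V.isValue) (hM : M.isValue = false)
    (h : StepValid M N) : StepValid (.app V M) (.app V N) := by
  intro ρ p
  obtain ⟨⟨P, t, hP⟩, hMN⟩ := h (ρ.up 2) 0
  rw [optEnc_value_app hV hM]
  refine ⟨⟨_, .res_tau (.parR _ (.res_tau (.parL _ t))), ?_⟩, .appR_context hV ρ p hMN⟩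
  rw [Act.bn, shift_zero, shift_zero]
  exact .appR_context hV ρ p hP

theorem StepValid.appL {L M N : Term} (hM : M.isValue = false)
    (h : StepValid M N) : StepValid (.app M L) (.app N L) := by
  intro ρ p
  obtain ⟨⟨P, t, hP⟩, hMN⟩ := h (ρ.up 1) 0
  cases hL : L.isValue with
  | true =>
    rw [optEnc_app_value hM hL]
    refine ⟨⟨_, .res_tau (.parL _ t), ?_⟩, .appL_value_context hL ρ p hMN⟩
    rw [Act.bn, shift_zero]
    exact .appL_value_context hL ρ p hP
  | false =>
    rw [optEnc_app_app hM hL]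
    refine ⟨⟨_, .res_tau (.parL _ t), ?_⟩, .appL_context hL ρ p hMN⟩
    rw [Act.bn, shift_zero]
    exact .appL_context hL ρ p hP

theorem BetaV.stepValid {M N : Term} (h : BetaV M N) : StepValid M N := by
  obtain ⟨E, M, V, hV⟩ := h
  induction E with
  | hole => exact stepValid_redex M hV
  | appR W hW E ih => exact ih.appR hW (E.isValue_fill_app _ _)
  | appL E L ih => exact ih.appL (E.isValue_fill_app _ _)

end CbvPiI

/-- Validity of beta_v-reduction for the optimised encoding. The hypothesis `hp` says that the
continuation name `p` is not one of the names that stand for lambda-variables. -/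
theorem mainTheorem1 (M N : CbvPiI.Term) (h : CbvPiI.BetaV M N)
    (ρ : CbvPiI.Env) (p : CbvPiI.Name) (hp : ∀ x, ρ x ≠ p) :
    (∃ P, CbvPiI.Trans (CbvPiI.optEnc M ρ p) CbvPiI.Act.tau P ∧
      CbvPiI.Expands P (CbvPiI.optEnc N ρ p)) ∧
    CbvPiI.Expands (CbvPiI.optEnc M ρ p) (CbvPiI.optEnc N ρ p) :=
  h.stepValid ρ p
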